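/- **Setting.** Let $p$ be a prime, $\mathbb F$ a field of characteristic $p$ (for example a finite field or $\overline{\mathbb F}_p$), $K=\mathbb F((t))$ with normalized valuation $v_K$, and write $\wp(a)=a^p-a$, $\phi(a)=a^p$. Let $n\ge 0$ and let $L=K(x_0,\dots,x_n)$ be a near one-dimensional elementary abelian extension, that is, $$\wp(x_i)=\phi^n(\Omega_i)\,\beta+\varepsilon_i\qquad(0\le i\le n),$$ where * $\beta\in K$, $v_K(\beta)=-b$ with $b>0$ and $\gcd(b,p)=1$; * $\Omega_0=1,\Omega_1,\dots,\Omega_n\in K$ are linearly independent over $\mathbb F_p$, $v_K(\Omega_n)\le\cdots\le v_K(\Omega_1)\le v_K(\Omega_0)=0$, and whenever $v_K(\Omega_i)=\cdots=v_K(\Omega_j)$ with $i<j$, the images of $\Omega_i,\dots,\Omega_j$ in $\Omega_i\mathfrak O_K/\Omega_i\mathfrak P_K$ are linearly independent over $\mathbb F_p$, where $\mathfrak O_K$ is the valuation ring and $\mathfrak P_K$ its maximal ideal; * with $m_i=v_K(\Omega_{i-1})-v_K(\Omega_i)$ for $1\le i\le n$, the error terms $\varepsilon_i\in K$ satisfy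 $$v_K(\varepsilon_i)>-\frac b{p^n}-\sum_{j=1}^i p^jm_j+\sum_{j=i+1}^n(p^n-p^j)m_j\qquad(0\le i\le n),$$ (in particular $\varepsilon_i=0$ is allowed). Put $b_{(j)}=b+p^n\sum_{k=1}^j p^km_k$. Define $\Omega_j^{(0)}=\Omega_j$ and $\Omega_j^{(i)}=\wp(\Omega_j^{(i-1)})/\wp(\Omega_i^{(i-1)})$ for $1\le i\le j\le n$ (so $\Omega_j^{(j)}=1$). Let $[\Omega^\phi]$ be the upper unitriangular matrix with rows and columns indexed by $0,\dots,n$ whose $(i,j)$ entry for $i<j$ is $\phi^{n-i-1}(\Omega_j^{(i)})$. Define $X_j^{(0)}=x_j$ and $X_j^{(i)}=X_j^{(i-1)}-\phi^{n-i}(\Omega_j^{(i-1)})X_{i-1}^{(i-1)}$ for $1\le i\le j\le n$. Let $K_{-1}=K$, $K_j=K(x_0,\dots,x_j)$, let $v_j$ be the normalized valuation of $K_j$ and $v_L=v_n$; let $G=\mathrm{Gal}(L/K)$ and $G_r=\{\sigma\in G: v_L((\sigma-1)\pi_L)\ge r+1\}$, $\pi_L$ a prime element of $L$. **Proposition.**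 $L/K$ is a fully ramified elementary abelian extension of degree $p^{n+1}$; $b_{(0)}\le\cdots\le b_{(n)}$, and $\{b_{(0)},\dots,b_{(n)}\}$ is the set of its lower ramification breaks. For $0\le j\le n$, $$X_j^{(j)}\in K_j\quad\text{and}\quad v_j(X_j^{(j)})=-b_{(j)}.$$ There are $\sigma_0,\dots,\sigma_n\in G$ with $(\sigma_i-1)x_j=\delta_{ij}$, and the matrix $[\Delta]$ with entries $\Delta_{i,j}=(\sigma_i-1)X_j^{(j)}$ equals $[\Omega^\phi]^{-1}$; in particular all $\Delta_{i,j}$ lie in $K$. Moreover Assumption 1 holds for $L/K$ with these $\sigma_i$ and $X_j=X_j^{(j)}$. That is, with $G_{(i)}=\langle\sigma_i,\dots,\sigma_n\rangle$: * $G=G_{(0)}\supsetneq G_{(1)}\supsetneq\cdots\supsetneq G_{(n+1)}=\{e\}$ has steps of index $p$ and includes all ramification groups $G_r$, and the fixed field of $G_{(i)}$ is $K_{i-1}$; * $b_{(i)}=v_L((\sigma_i-1)\pi_L)-1$ for every prime element $\pi_L$ of $L$; * $X_i\in K_i$, $v_i(X_i)=-b_{(i)}$, $\wp(X_i)\in K_{i-1}$,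 $\sigma_iX_i=X_i+1$; and * $\Delta_{i,j}=(\sigma_i-1)X_j\in K$ for all $0\le i,j\le n$. -/

import Mathlib

noncomputable section

namespace NearOneDim

/-! ### Normalized valuations over `K = F((t))` -/

/-- The normalized additive valuation `v_K` of `K = F((t))`, with `v_K t = 1` and `v_K 0 = ⊤`. -/
abbrev vK (F : Type*) [Field F] : AddValuation (LaurentSeries F) (WithTop ℤ) :=
  HahnSeries.addVal ℤ F

section Valuation

variable (F : Type*) [Field F] (E : Type*) [Field E] [Algebra (LaurentSeries F) E]

/-- `w` is a normalized additive valuation of `E` extending `v_K`: it maps onto `ℤ ∪ {⊤}`, and its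
restriction to `K` is a positive multiple (by the ramification index) of `v_K`. -/
def IsNormalizedExtension (w : AddValuation E (WithTop ℤ)) : Prop :=
  Function.Surjective w ∧
    ∃ e : ℕ, 0 < e ∧ ∀ a : LaurentSeries F, w (algebraMap (LaurentSeries F) E a) = e • vK F a

open Classical in
instance : Nonempty (AddValuation E (WithTop ℤ)) := ⟨AddValuation.ofValuation 1⟩

/-- The normalized additive valuation `v_E` of a finite extension `E` of `K = F((t))`: the one
valuation with `IsNormalizedExtension`. (Only meaningful when there is exactly one such valuation,
which the theorem asserts for every field to which it applies `vE`.) -/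
def vE : AddValuation E (WithTop ℤ) :=
  Classical.epsilon (fun w => IsNormalizedExtension F E w)

/-- `E / K` is fully (= totally) ramified: the ramification index is the degree. -/
def IsFullyRamified : Prop :=
  IsNormalizedExtension F E (vE F E) ∧
    ∀ a : LaurentSeries F,
      vE F E (algebraMap (LaurentSeries F) E a) =
        Module.finrank (LaurentSeries F) E • vK F a

/-- `E / K` is a fully ramified abelian extension of degree `d`. -/
structure IsFullyRamifiedAbelian (d : ℕ) : Prop where
  isGalois : IsGalois (LaurentSeries F) E
  comm : ∀ σ τ : E ≃ₐ[LaurentSeries F] E, σ * τ = τ * σ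
  degree : Module.finrank (LaurentSeries F) E = d
  ramified : IsFullyRamified F E

end Valuation

/-! ### Ramification groups and Assumption 1 -/

section Ramification

variable {F : Type*} [Field F] {L : Type*} [Field L] [Algebra (LaurentSeries F) L]

/-- The ramification group `G_r = {σ : v_L ((σ - 1) π_L) ≥ r + 1}`, `π_L` a prime element. -/
def ramificationGroup (F : Type*) [Field F] (L : Type*) [Field L] [Algebra (LaurentSeries F) L]
    (r : ℤ) : Set (L ≃ₐ[LaurentSeries F] L) :=
  {σ | ∀ π : L, vE F L π = 1 → ((r + 1 : ℤ) : WithTop ℤ) ≤ vE F L (σ π - π)}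

/-- The (lower) ramification break numbers of `L / K`: the `r` with `G_{r+1} ≠ G_r`. -/
def lowerBreaks (F : Type*) [Field F] (L : Type*) [Field L] [Algebra (LaurentSeries F) L] :
    Set ℤ :=
  {r | ramificationGroup F L (r + 1) ≠ ramificationGroup F L r}

/-- `c = v_L ((σ - 1) π_L) - 1` for a prime element `π_L` of `L`. -/
def HasBreak (σ : L ≃ₐ[LaurentSeries F] L) (c : ℤ) : Prop :=
  ∀ π : L, vE F L π = 1 → vE F L (σ π - π) = ((c + 1 : ℤ) : WithTop ℤ)

/-- `G_(i) = ⟨σ_i, σ_{i+1}, …, σ_n⟩`; in particular `G_(n+1)` is trivial. -/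
def Gsub (n : ℕ) (σ : ℕ → (L ≃ₐ[LaurentSeries F] L)) (i : ℕ) :
    Subgroup (L ≃ₐ[LaurentSeries F] L) :=
  Subgroup.closure (σ '' Set.Icc i n)

/-- The fixed field of `G_(i+1)`, which is denoted `K_i`; the fixed field of `G_(0) = G` is
`K_{-1} = K`. -/
abbrev fixedBy (n : ℕ) (σ : ℕ → (L ≃ₐ[LaurentSeries F] L)) (i : ℕ) :
    IntermediateField (LaurentSeries F) L :=
  IntermediateField.fixedField (Gsub n σ i)

/-- The generators `σ_0, …, σ_n` "organize" `G = Gal(L/K)`: the groups `G_(i)` form a filtration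
from `G` to the trivial group with steps of index `p` which includes all ramification groups. -/
structure IsOrganized (p n : ℕ) (σ : ℕ → (L ≃ₐ[LaurentSeries F] L)) : Prop where
  top : Gsub n σ 0 = ⊤
  step : ∀ i ≤ n, (Gsub n σ (i + 1)).relIndex (Gsub n σ i) = p
  ramification : ∀ r : ℤ, ∃ i ≤ n + 1,
    ((Gsub n σ i : Subgroup _) : Set (L ≃ₐ[LaurentSeries F] L)) = ramificationGroup F L r

/-- The choices from which the matrix `Δ_{i,j} = (σ_i - 1) X_j` is made: organized generators `σ_i`
with break numbers `b_(i) = v_L ((σ_i - 1) π_L) - 1`, and elements `X_i ∈ K_i` such that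
`v_i (X_i) = -b_(i)`, `X_i ^ p - X_i ∈ K_{i-1}` and `σ_i X_i = X_i + 1`. -/
structure IsChoice (p n : ℕ) (σ : ℕ → (L ≃ₐ[LaurentSeries F] L)) (c : ℕ → ℤ) (X : ℕ → L) :
    Prop where
  organized : IsOrganized p n σ
  hasBreak : ∀ i ≤ n, HasBreak (σ i) (c i)
  valuation : ∀ i ≤ n, ∃ h : X i ∈ fixedBy n σ (i + 1),
    vE F (fixedBy n σ (i + 1)) ⟨X i, h⟩ = ((-(c i) : ℤ) : WithTop ℤ)
  artinSchreier : ∀ i ≤ n, X i ^ p - X i ∈ fixedBy n σ i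
  apply_self : ∀ i ≤ n, σ i (X i) = X i + 1

/-- All entries `Δ_{i,j} = (σ_i - 1) X_j`, `0 ≤ i, j ≤ n`, lie in `K`. -/
def EntriesInBase (n : ℕ) (σ : ℕ → (L ≃ₐ[LaurentSeries F] L)) (X : ℕ → L) : Prop :=
  ∀ i ≤ n, ∀ j ≤ n, σ i (X j) - X j ∈ Set.range (algebraMap (LaurentSeries F) L)

/-- Assumption 1 for a fully ramified abelian extension `L / K` of degree `p ^ (n + 1)`: for suitable
choices of the `σ_i` and `X_i`, all `Δ_{i,j}` lie in `K`. -/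
def SatisfiesAssumption1 (p n : ℕ) (F : Type*) [Field F] (L : Type*) [Field L]
    [Algebra (LaurentSeries F) L] : Prop :=
  IsFullyRamifiedAbelian F L (p ^ (n + 1)) ∧
    ∃ (σ : ℕ → (L ≃ₐ[LaurentSeries F] L)) (c : ℕ → ℤ) (X : ℕ → L),
      IsChoice p n σ c X ∧ EntriesInBase n σ X

end Ramification

/-! ### Near one-dimensional elementary abelian extensions

Sequences are indexed by `ℕ`; only their members with index at most `n` are ever used. -/

section Data

variable {F : Type*} [Field F]

/-- `m_i = v_K (Ω_{i-1}) - v_K (Ω_i)` for `i ≥ 1` (used when all `Ω_i` are non-zero). -/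
def m (Ω : ℕ → LaurentSeries F) (i : ℕ) : ℤ :=
  (Ω (i - 1)).order - (Ω i).order

/-- `b_(j) = b + p ^ n * ∑_{k=1}^{j} p ^ k m_k`. -/
def bLow (p n b : ℕ) (Ω : ℕ → LaurentSeries F) (j : ℕ) : ℤ :=
  b + p ^ n * ∑ k ∈ Finset.Icc 1 j, (p : ℤ) ^ k * m Ω k

/-- The bound for the `i`-th error term,
`-b / p ^ n - ∑_{j=1}^{i} p ^ j m_j + ∑_{j=i+1}^{n} (p ^ n - p ^ j) m_j`. -/
def errorBound (p n b : ℕ) (Ω : ℕ → LaurentSeries F) (i : ℕ) : ℚ :=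
  -((b : ℚ) / (p : ℚ) ^ n) - ∑ j ∈ Finset.Icc 1 i, (p : ℚ) ^ j * (m Ω j : ℚ)
    + ∑ j ∈ Finset.Icc (i + 1) n, ((p : ℚ) ^ n - (p : ℚ) ^ j) * (m Ω j : ℚ)

/-- `L = K(x_0, …, x_n)` is a near one-dimensional elementary abelian extension of `K = F((t))`
with Artin-Schreier equations `x_i ^ p - x_i = Ω_i ^ (p ^ n) * β + ε_i`. -/
structure IsNearOneDim (p n : ℕ) [Algebra (ZMod p) F]
    {L : Type*} [Field L] [Algebra (LaurentSeries F) L]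
    (b : ℕ) (β : LaurentSeries F) (Ω ε : ℕ → LaurentSeries F) (x : ℕ → L) : Prop where
  b_pos : 0 < b
  b_coprime : Nat.Coprime b p
  val_β : vK F β = ((-(b : ℤ) : ℤ) : WithTop ℤ)
  Ω_zero : Ω 0 = 1
  /-- The `Ω_i` span a space of dimension `n + 1` over `𝔽_p`. -/
  Ω_indep : LinearIndependent (ZMod p) (fun i : Fin (n + 1) => Ω i)
  /-- `v_K (Ω_n) ≤ ⋯ ≤ v_K (Ω_1) ≤ v_K (Ω_0)`. -/
  Ω_antitone : ∀ i < n, vK F (Ω (i + 1)) ≤ vK F (Ω i)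
  /-- If `v_K (Ω_i) = ⋯ = v_K (Ω_j)`, then the images of `Ω_i, …, Ω_j` in the quotient of
  `{a | v_K a ≥ v_K Ω_i}` by `{a | v_K a > v_K Ω_i}` are linearly independent over `𝔽_p`. -/
  Ω_leading : ∀ i j, i ≤ j → j ≤ n → vK F (Ω i) = vK F (Ω j) → ∀ a : ℕ → ZMod p,
    vK F (Ω i) < vK F (∑ k ∈ Finset.Icc i j, a k • Ω k) → ∀ k ∈ Finset.Icc i j, a k = 0
  /-- The error terms are small; `ε_i = 0` is allowed, as `v_K 0 = ∞`. -/
  ε_bound : ∀ i ≤ n, ε i ≠ 0 → errorBound p n b Ω i < ((ε i).order : ℚ)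
  equation : ∀ i ≤ n,
    x i ^ p - x i = algebraMap (LaurentSeries F) L (Ω i ^ p ^ n * β + ε i)
  generate : IntermediateField.adjoin (LaurentSeries F) (x '' Set.Iic n) = ⊤

/-- `Ω_j^{(i)}` (for `j ≥ i`): `Ω_j^{(0)} = Ω_j` and, with `℘ a = a ^ p - a`,
`Ω_j^{(i)} = ℘ (Ω_j^{(i-1)}) / ℘ (Ω_i^{(i-1)})`. -/
def OmegaRec (p : ℕ) (Ω : ℕ → LaurentSeries F) : ℕ → ℕ → LaurentSeries F
  | 0, j => Ω j
  | i + 1, j => (OmegaRec p Ω i j ^ p - OmegaRec p Ω i j) /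
      (OmegaRec p Ω i (i + 1) ^ p - OmegaRec p Ω i (i + 1))

/-- The matrix `[Ω^φ] = [φ^{n-i-1} (Ω_j^{(i)})]_{0 ≤ i, j ≤ n}`, where `φ a = a ^ p`. It is upper
triangular with ones on the diagonal (in the last row, `φ^{-1}` is only applied to `0` and `1`). -/
def OmegaPhi (p n : ℕ) (Ω : ℕ → LaurentSeries F) :
    Matrix (Fin (n + 1)) (Fin (n + 1)) (LaurentSeries F) :=
  fun i j => if j < i then 0 else if j = i then 1 else
    OmegaRec p Ω i j ^ p ^ (n - 1 - (i : ℕ))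

variable {L : Type*} [Field L] [Algebra (LaurentSeries F) L]

/-- `X_j^{(i)}` (for `i ≤ j ≤ n`): `X_j^{(0)} = x_j` and
`X_j^{(i)} = X_j^{(i-1)} - φ^{n-i} (Ω_j^{(i-1)}) X_{i-1}^{(i-1)}`. -/
def XRec (p n : ℕ) (Ω : ℕ → LaurentSeries F) (x : ℕ → L) : ℕ → ℕ → L
  | 0, j => x j
  | i + 1, j => XRec p n Ω x i j -
      algebraMap (LaurentSeries F) L (OmegaRec p Ω i j ^ p ^ (n - (i + 1))) * XRec p n Ω x i i

/-- `K_j = K(x_0, …, x_j)`. -/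
abbrev Kfield (F : Type*) [Field F] {L : Type*} [Field L] [Algebra (LaurentSeries F) L]
    (x : ℕ → L) (j : ℕ) : IntermediateField (LaurentSeries F) L :=
  IntermediateField.adjoin (LaurentSeries F) (x '' Set.Iic j)

end Data

end NearOneDim

end

/-!
The proof compares all valuation rings that lie over `𝔒_K` instead of constructing one valuation
after another along the tower `K ⊂ K_0 ⊂ ⋯ ⊂ K_n`. As usual `℘ y = y ^ p - y` (`wp` in names) and
`φ y = y ^ p`, and `X_j` stands for `X_j^{(j)}`.

*The equations of the `X_j`.* Subtracting multiples of the earlier `X_i` cancels main terms, so that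
`℘ (X_{j+1}) = -φ^{n-j-1} (℘ (Ω_{j+1}^{(j)})) X_j + E_{j+1}` with an error `E_{j+1} ∈ K`
(`IsNearOneDim.wp_XRec`). The leading independence of the `Ω_j` passes to the `Ω_j^{(i)}`, because
`℘ y = ∏ (y - c)` over `c ∈ 𝔽_p` and `Ω_i^{(i)} = 1` (`IsNearOneDim.vK_add_sum_OmegaRec`); hence
`v_K (Ω_j^{(i)}) = p ^ i (v_K (Ω_j) - v_K (Ω_i))`. The bound on the errors is stable under the
recursion, hence the main term dominates, and *every* valuation `v` of an extension field that
extends `v_K` satisfies `v (X_j) = -b_(j) / p ^ (j+1)` (`IsNearOneDim.val_X`).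

*Valuations.* Since `b_(j)` is prime to `p`, an element of `K_j`, written as a polynomial in `X_j` of
degree below `p` over `K_{j-1}`, has terms with distinct values. By induction its value does not
depend on the chosen extension of `v_K` and lies in `p ^ -(j+1) ℤ` (`IsNearOneDim.exists_exponent`).
As there is some valuation ring over `𝔒_K`, this gives existence and uniqueness of the normalized
valuation, with ramification index `p ^ (j+1)` (`IsNearOneDim.exists_normalized`). The powers
`X_n ^ k` with `k < p ^ (n+1)` have distinct values modulo the ramification index, so the degree is at
least `p ^ (n+1)`, whereas `τ ↦ ((τ - 1) x_i)_i` embeds the Galois group into `𝔽_p ^ (n+1)`. Hence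
both have order `p ^ (n+1)`, and the `σ_i` exist (`IsNearOneDim.coord_bijective`).

*Ramification.* Let `x_i` be the first generator that `τ` moves. The `d_j = (τ - 1) X_j` with `j ≥ i`
satisfy the homogeneous parts of the equations of the `X_j`, and `d_i ∈ 𝔽_p` is a unit. The same
computation gives `v_L (d_n) = b_(i) - b_(n)` (`IsNearOneDim.val_of_homogeneous`). Expanding a prime
element in powers of `X_n` transfers this to the break `b_(i)` of `τ` (`IsNearOneDim.hasBreak`), which
determines all ramification groups. Finally, `[x_j] = [X_j] [Ω^φ]`, and applying `σ_i - 1` yields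
`1 = [Δ] [Ω^φ]`.
-/

set_option linter.unusedSectionVars false

noncomputable section

namespace NearOneDim

/-! ### The recursion for the `Ω_j^{(i)}` -/

section

open Polynomial Finset

variable {p n : ℕ} [Fact p.Prime] {F : Type*} [Field F]

lemma exists_int_of_ne_zero {M : Type*} [Field M] (w : AddValuation M (WithTop ℤ)) {z : M} (hz : z ≠ 0) :
    ∃ r : ℤ, w z = r := by
  obtain ⟨r, hr⟩ := WithTop.ne_top_iff_exists.1 ((AddValuation.ne_top_iff w).2 hz)
  exact ⟨r, hr.symm⟩

lemma nsmul_coe (e : ℕ) (r : ℤ) : e • (r : WithTop ℤ) = ((e * r : ℤ) : WithTop ℤ) := by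
  rw [← nsmul_eq_mul]
  rfl

lemma vK_mul {x y : LaurentSeries F} {a c : ℤ} (hx : vK F x = a) (hy : vK F y = c) :
    vK F (x * y) = ((a + c : ℤ) : WithTop ℤ) := by
  rw [AddValuation.map_mul, hx, hy, WithTop.coe_add]

lemma vK_pow {x : LaurentSeries F} {a : ℤ} (hx : vK F x = a) (k : ℕ) :
    vK F (x ^ k) = ((k * a : ℤ) : WithTop ℤ) := by
  induction k with
  | zero => simp
  | succ k ih =>
    rw [pow_succ, vK_mul ih hx]
    congr 1
    push_cast
    ring

lemma ne_zero_of_vK {x : LaurentSeries F} {a : ℤ} (hx : vK F x = a) : x ≠ 0 := by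
  rintro rfl
  simp at hx

lemma order_of_vK {x : LaurentSeries F} {a : ℤ} (hx : vK F x = a) : x.order = a := by
  rw [HahnSeries.addVal_apply_of_ne (ne_zero_of_vK hx)] at hx
  exact_mod_cast hx

lemma vK_div {x y : LaurentSeries F} {a c : ℤ} (hx : vK F x = a) (hy : vK F y = c) :
    vK F (x / y) = ((a - c : ℤ) : WithTop ℤ) := by
  have h0 : x / y ≠ 0 := div_ne_zero (ne_zero_of_vK hx) (ne_zero_of_vK hy)
  have h1 : vK F (x / y) = ((x / y).order : ℤ) := HahnSeries.addVal_apply_of_ne h0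
  have h2 := vK_mul h1 hy
  rw [div_mul_cancel₀ _ (ne_zero_of_vK hy), hx] at h2
  rw [h1]
  have : a = (x / y).order + c := by exact_mod_cast h2
  rw [this]
  congr 1
  ring

/-- Valuations are trivial on the prime field. -/
lemma addVal_algebraMap_zmod {M : Type*} [Field M] [Algebra (ZMod p) M]
    (w : AddValuation M (WithTop ℤ)) {a : ZMod p} (ha : a ≠ 0) :
    w (algebraMap (ZMod p) M a) = 0 := by
  obtain ⟨r, hr⟩ := exists_int_of_ne_zero w ((map_ne_zero (algebraMap (ZMod p) M)).2 ha)
  have h1 : p • w (algebraMap (ZMod p) M a) = w (algebraMap (ZMod p) M a) := by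
    rw [← w.map_pow, ← map_pow, ZMod.pow_card]
  rw [hr, nsmul_coe] at h1
  have h2 : (p : ℤ) * r = r := by exact_mod_cast h1
  have hp : (1 : ℤ) < p := by exact_mod_cast (Fact.out : p.Prime).one_lt
  have h3 : r = 0 := by
    have : ((p : ℤ) - 1) * r = 0 := by linarith
    rcases mul_eq_zero.1 this with h | h
    · omega
    · exact h
  rw [hr, h3]
  rfl

section CharP

variable [Algebra (ZMod p) F]

variable (p F) in
lemma charP_laurentSeries : CharP (LaurentSeries F) p :=
  charP_of_injective_algebraMap (algebraMap (ZMod p) (LaurentSeries F)).injective p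

/-- The Artin-Schreier polynomial `X ^ p - X` splits over `𝔽_p` into all linear factors. -/
lemma pow_sub_self_eq_prod {R : Type*} [CommRing R] [Algebra (ZMod p) R] (y : R) :
    y ^ p - y = ∏ c : ZMod p, (y - algebraMap (ZMod p) R c) := by
  have h : (X ^ p - X : (ZMod p)[X]) = ∏ c : ZMod p, (X - C c) := by
    have hp := (Fact.out : p.Prime).one_lt
    have hr := FiniteField.roots_X_pow_card_sub_X (ZMod p)
    rw [ZMod.card] at hr
    have hm : (X ^ p - X : (ZMod p)[X]).Monic := by
      apply monic_X_pow_sub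
      rw [degree_X]
      exact_mod_cast hp
    have hc := prod_multiset_X_sub_C_of_monic_of_roots_card_eq hm (by
      rw [hr, FiniteField.X_pow_card_sub_X_natDegree_eq _ hp]
      simp [ZMod.card])
    rw [← hc, hr]
    rfl
  have h2 := congrArg (aeval y) h
  simpa using h2

/-- If `y` is at the same distance from every element of `𝔽_p`, then `v_K (℘ y) = p v_K (y)`. -/
lemma vK_pow_sub_self {y : LaurentSeries F} {r : ℤ}
    (hy : ∀ c : ZMod p, vK F (y - algebraMap (ZMod p) _ c) = r) :
    vK F (y ^ p - y) = ((p * r : ℤ) : WithTop ℤ) := by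
  have key : ∀ s : Finset (ZMod p),
      vK F (∏ c ∈ s, (y - algebraMap (ZMod p) (LaurentSeries F) c)) =
        ((#s * r : ℤ) : WithTop ℤ) := by
    intro s
    induction s using Finset.induction_on with
    | empty => simp
    | insert c s hc ih =>
      rw [prod_insert hc, vK_mul (hy c) ih, card_insert_of_notMem hc]
      congr 1
      push_cast
      ring
  rw [pow_sub_self_eq_prod, key, card_univ, ZMod.card]

/-- The coefficientwise action of `𝔽_p` on `F((t))` agrees with the one through the prime field.
This is not definitional: the algebra structure is found through `F⟦t⟧`. -/
lemma zmod_smul_eq_mul (a : ZMod p) (y : LaurentSeries F) :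
    a • y = algebraMap (ZMod p) (LaurentSeries F) a * y := by
  conv_lhs => rw [← ZMod.natCast_zmod_val a]
  conv_rhs => rw [← ZMod.natCast_zmod_val a]
  rw [Nat.cast_smul_eq_nsmul, map_natCast, nsmul_eq_mul]

lemma smul_pow_char (a : ZMod p) (y : LaurentSeries F) : (a • y) ^ p = a • y ^ p := by
  rw [zmod_smul_eq_mul, zmod_smul_eq_mul, mul_pow, ← map_pow, ZMod.pow_card]

/-- `℘` is additive and `𝔽_p`-linear. -/
lemma pow_sub_self_add_sum (y : LaurentSeries F) (s : Finset ℕ) (a : ℕ → ZMod p)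
    (z : ℕ → LaurentSeries F) :
    (y + ∑ k ∈ s, a k • z k) ^ p - (y + ∑ k ∈ s, a k • z k) =
      (y ^ p - y) + ∑ k ∈ s, a k • (z k ^ p - z k) := by
  have := charP_laurentSeries p F
  rw [add_pow_char, sum_pow_char]
  simp only [smul_pow_char, smul_sub, sum_sub_distrib]
  ring

variable {L : Type*} [Field L] [Algebra (LaurentSeries F) L]
  {b : ℕ} {β : LaurentSeries F} {Ω ε : ℕ → LaurentSeries F} {x : ℕ → L}

namespace IsNearOneDim

lemma vK_Ω (hL : IsNearOneDim p n b β Ω ε x) {j : ℕ} (hj : j ≤ n) : vK F (Ω j) = (Ω j).order := by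
  apply HahnSeries.addVal_apply_of_ne
  induction j with
  | zero => rw [hL.Ω_zero]; exact one_ne_zero
  | succ j ih =>
    intro h0
    have h1 := hL.Ω_antitone j hj
    rw [h0, HahnSeries.addVal_apply_of_ne (ih (by omega))] at h1
    simp at h1

lemma vK_Ω_le (hL : IsNearOneDim p n b β Ω ε x) {i j : ℕ} (hij : i ≤ j) (hj : j ≤ n) :
    vK F (Ω j) ≤ vK F (Ω i) := by
  induction j, hij using Nat.le_induction with
  | base => exact le_rfl
  | succ j hij ih => exact (hL.Ω_antitone j hj).trans (ih (by omega))

lemma order_Ω_le (hL : IsNearOneDim p n b β Ω ε x) {i j : ℕ} (hij : i ≤ j) (hj : j ≤ n) :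
    (Ω j).order ≤ (Ω i).order := by
  have h := hL.vK_Ω_le hij hj
  rw [hL.vK_Ω hj, hL.vK_Ω (hij.trans hj)] at h
  exact_mod_cast h

lemma m_nonneg (hL : IsNearOneDim p n b β Ω ε x) {k : ℕ} (hk : k ≤ n) : 0 ≤ m Ω k :=
  sub_nonneg.2 (hL.order_Ω_le (Nat.sub_le k 1) hk)

lemma le_vK_smul {y : LaurentSeries F} {r : WithTop ℤ} (h : r ≤ vK F y) (a : ZMod p) :
    r ≤ vK F (a • y) := by
  by_cases ha : a = 0
  · simp [ha]
  · rw [zmod_smul_eq_mul, AddValuation.map_mul, addVal_algebraMap_zmod _ ha]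
    simpa using h

/-- The last member of an `𝔽_p`-combination of the `Ω_k` determines its valuation. -/
lemma vK_add_sum_Ω (hL : IsNearOneDim p n b β Ω ε x) {j : ℕ} (hj : j ≤ n) (a : ℕ → ZMod p) :
    vK F (Ω j + ∑ k ∈ Ico 0 j, a k • Ω k) = (Ω j).order := by
  classical
  -- `i` is the first index with `v_K (Ω_i) = v_K (Ω_j)`
  have hex : ∃ i, vK F (Ω i) = vK F (Ω j) := ⟨j, rfl⟩
  set i := Nat.find hex with hi
  have hiv : vK F (Ω i) = vK F (Ω j) := Nat.find_spec hex
  have hij : i ≤ j := Nat.find_min' hex rfl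
  have hlow : vK F (Ω j) < vK F (∑ k ∈ Ico 0 i, a k • Ω k) := by
    apply AddValuation.map_lt_sum
    · rw [hL.vK_Ω hj]; exact WithTop.coe_ne_top
    · intro k hk
      have hki : k < i := (mem_Ico.1 hk).2
      have h1 : vK F (Ω j) < vK F (Ω k) :=
        lt_of_le_of_ne (hL.vK_Ω_le (by omega) hj) (Ne.symm (Nat.find_min hex hki))
      exact h1.trans_le (le_vK_smul le_rfl _)
  have hhigh : vK F (Ω j + ∑ k ∈ Ico i j, a k • Ω k) = vK F (Ω j) := by
    apply le_antisymm
    · by_contra! hlt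
      have h1 : Ω j + ∑ k ∈ Ico i j, a k • Ω k =
          ∑ k ∈ Icc i j, (if k = j then 1 else a k) • Ω k := by
        rw [← Finset.Ico_insert_right hij, sum_insert (by simp)]
        simp only [if_true, one_smul]
        congr 1
        apply sum_congr rfl
        intro k hk
        rw [if_neg (ne_of_lt (mem_Ico.1 hk).2)]
      rw [h1, ← hiv] at hlt
      have h2 := hL.Ω_leading i j hij hj hiv _ hlt j (by simp [hij])
      simp at h2
    · apply AddValuation.map_le_add _ le_rfl
      apply AddValuation.map_le_sum
      intro k hk
      apply le_vK_smul
      exact hL.vK_Ω_le (mem_Ico.1 hk).2.le hj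
  rw [← sum_Ico_consecutive _ (Nat.zero_le i) hij, add_comm (∑ k ∈ Ico 0 i, a k • Ω k),
    ← add_assoc, ← hL.vK_Ω hj, ← hhigh]
  rw [add_comm]
  apply AddValuation.map_add_eq_of_lt_right
  rw [hhigh]
  exact hlow

/-- The recursion preserves leading independence: since `℘ y` is the product of the translates
`y - c` with `c ∈ 𝔽_p`, and `Ω_i^{(i)} = 1`, the valuation of `℘` of a combination of the
`Ω_k^{(i)}` with `k > i` is `p` times that of its last member. -/
lemma vK_add_sum_OmegaRec (hL : IsNearOneDim p n b β Ω ε x) (i : ℕ) (hi : i ≤ n) :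
    OmegaRec p Ω i i = 1 ∧ ∀ j, i ≤ j → j ≤ n → ∀ a : ℕ → ZMod p,
      vK F (OmegaRec p Ω i j + ∑ k ∈ Ico i j, a k • OmegaRec p Ω i k) =
        ((p ^ i * ((Ω j).order - (Ω i).order) : ℤ) : WithTop ℤ) := by
  induction i with
  | zero =>
    refine ⟨hL.Ω_zero, fun j _ hj a => ?_⟩
    have h := hL.vK_add_sum_Ω hj a
    simpa [OmegaRec, hL.Ω_zero] using h
  | succ i ih =>
    obtain ⟨h1, h2⟩ := ih (by omega)
    -- the valuation of `℘` of a combination which omits `Ω_i^{(i)}`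
    have hwp : ∀ j, i + 1 ≤ j → j ≤ n → ∀ a : ℕ → ZMod p,
        vK F ((OmegaRec p Ω i j + ∑ k ∈ Ico (i + 1) j, a k • OmegaRec p Ω i k) ^ p -
          (OmegaRec p Ω i j + ∑ k ∈ Ico (i + 1) j, a k • OmegaRec p Ω i k)) =
        ((p * (p ^ i * ((Ω j).order - (Ω i).order)) : ℤ) : WithTop ℤ) := by
      intro j hij hj a
      apply vK_pow_sub_self
      intro c
      have hs : ∑ k ∈ Ico (i + 1) j, (if k = i then -c else a k) • OmegaRec p Ω i k =
          ∑ k ∈ Ico (i + 1) j, a k • OmegaRec p Ω i k := by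
        refine sum_congr rfl fun k hk => ?_
        rw [if_neg (by have := (mem_Ico.1 hk).1; omega)]
      rw [← h2 j (by omega) hj (fun k => if k = i then -c else a k),
        ← Finset.insert_Ico_add_one_left_eq_Ico (show i < j by omega), sum_insert (by simp)]
      congr 1
      rw [if_pos rfl, h1, hs, zmod_smul_eq_mul, map_neg, mul_one]
      ring
    have hden := hwp (i + 1) le_rfl hi 0
    simp only [Pi.zero_apply, zero_smul, sum_const_zero, add_zero] at hden
    refine ⟨div_self (ne_zero_of_vK hden), fun j hij hj a => ?_⟩
    have hnum := hwp j hij hj a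
    rw [pow_sub_self_add_sum] at hnum
    have := vK_div hnum hden
    rw [add_div, sum_div] at this
    simp only [OmegaRec]
    simp only [smul_div_assoc] at this
    rw [this]
    congr 1
    ring

lemma OmegaRec_self (hL : IsNearOneDim p n b β Ω ε x) {i : ℕ} (hi : i ≤ n) :
    OmegaRec p Ω i i = 1 :=
  (hL.vK_add_sum_OmegaRec i hi).1

lemma vK_OmegaRec (hL : IsNearOneDim p n b β Ω ε x) {i j : ℕ} (hij : i ≤ j) (hj : j ≤ n) :
    vK F (OmegaRec p Ω i j) = ((p ^ i * ((Ω j).order - (Ω i).order) : ℤ) : WithTop ℤ) := by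
  simpa using (hL.vK_add_sum_OmegaRec i (hij.trans hj)).2 j hij hj 0

lemma vK_wp_OmegaRec (hL : IsNearOneDim p n b β Ω ε x) {i j : ℕ} (hij : i < j) (hj : j ≤ n) :
    vK F (OmegaRec p Ω i j ^ p - OmegaRec p Ω i j) =
      ((p ^ (i + 1) * ((Ω j).order - (Ω i).order) : ℤ) : WithTop ℤ) := by
  have h : vK F (OmegaRec p Ω i j ^ p - OmegaRec p Ω i j) =
      ((p * (p ^ i * ((Ω j).order - (Ω i).order)) : ℤ) : WithTop ℤ) := by
    apply vK_pow_sub_self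
    intro c
    have := (hL.vK_add_sum_OmegaRec i (hij.le.trans hj)).2 j hij.le hj
      (fun k => if k = i then -c else 0)
    rw [← this]
    congr 1
    simp [ite_smul, hij, hL.OmegaRec_self (hij.le.trans hj), zmod_smul_eq_mul c,
      sub_eq_add_neg]
  rw [h]
  congr 1
  ring

end IsNearOneDim

end CharP

end

/-! ### The error terms of the reduced equations -/

section

open Finset

variable {p n : ℕ} [Fact p.Prime] {F : Type*} [Field F]

/-- The error terms of the reduced equations:
`℘ (X_j^{(i)}) = -φ^{n-i} (℘ (Ω_j^{(i-1)})) X_{i-1}^{(i-1)} + E_j^{(i)}` for `1 ≤ i ≤ j ≤ n`. -/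
def errRec (p n : ℕ) (Ω ε : ℕ → LaurentSeries F) : ℕ → ℕ → LaurentSeries F
  | 0, j => ε j
  | i + 1, j => errRec p n Ω ε i j - OmegaRec p Ω i j ^ p ^ (n - i) * errRec p n Ω ε i i

/-- `v_K (y) > q` for a rational bound `q`; this includes `y = 0`, whose value is `⊤`. -/
def OrderGT (q : ℚ) (y : LaurentSeries F) : Prop :=
  ∀ r : ℤ, vK F y = r → q < r

lemma OrderGT.sub {q : ℚ} {y z : LaurentSeries F} (hy : OrderGT q y) (hz : OrderGT q z) :
    OrderGT q (y - z) := by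
  have aux : ∀ {u : LaurentSeries F} {r : ℤ}, OrderGT q u → vK F u ≤ r → q < r := by
    intro u r hu hur
    obtain ⟨s, hs⟩ := WithTop.ne_top_iff_exists.1 (ne_top_of_le_ne_top WithTop.coe_ne_top hur)
    rw [← hs] at hur
    have h1 := hu s hs.symm
    have h2 : s ≤ r := by exact_mod_cast hur
    exact h1.trans_le (by exact_mod_cast h2)
  intro r hr
  have h := AddValuation.map_sub (vK F) y z
  rw [hr] at h
  rcases min_le_iff.1 h with h | h
  · exact aux hy h
  · exact aux hz h

lemma OrderGT.mul {q : ℚ} {s : ℤ} {a y : LaurentSeries F} (ha : vK F a = s) (hy : OrderGT q y) :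
    OrderGT (s + q) (a * y) := by
  intro r hr
  have h0 : y ≠ 0 := right_ne_zero_of_mul (ne_zero_of_vK hr)
  have h1 : vK F y = (y.order : ℤ) := HahnSeries.addVal_apply_of_ne h0
  have h2 := vK_mul ha h1
  rw [hr] at h2
  have h3 : r = s + y.order := by exact_mod_cast h2
  have h4 := hy _ h1
  rw [h3]
  push_cast
  linarith

lemma bLow_succ (b : ℕ) (Ω : ℕ → LaurentSeries F) (j : ℕ) :
    bLow p n b Ω (j + 1) = bLow p n b Ω j + p ^ (n + j + 1) * m Ω (j + 1) := by
  rw [bLow, bLow, sum_Icc_succ_top (by omega)]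
  ring

lemma bLow_zero (b : ℕ) (Ω : ℕ → LaurentSeries F) : bLow p n b Ω 0 = b := by
  simp [bLow]

lemma errorBound_succ (b : ℕ) (Ω : ℕ → LaurentSeries F) {j : ℕ} (hj : j + 1 ≤ n) :
    errorBound p n b Ω (j + 1) = errorBound p n b Ω j - p ^ n * m Ω (j + 1) := by
  rw [errorBound, errorBound, sum_Icc_succ_top (by omega),
    ← Finset.insert_Icc_add_one_left_eq_Icc hj, sum_insert (by simp)]
  ring

lemma errorBound_add (b : ℕ) (Ω : ℕ → LaurentSeries F) {i j : ℕ} (hij : i ≤ j) (hj : j ≤ n) :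
    ((p ^ n * ((Ω j).order - (Ω i).order) : ℤ) : ℚ) + errorBound p n b Ω i =
      errorBound p n b Ω j := by
  induction j, hij using Nat.le_induction with
  | base => simp
  | succ j hij ih =>
    rw [errorBound_succ b Ω hj, ← ih (by omega), m, Nat.add_sub_cancel]
    push_cast
    ring

variable [Algebra (ZMod p) F] {L : Type*} [Field L] [Algebra (LaurentSeries F) L]
  {b : ℕ} {β : LaurentSeries F} {Ω ε : ℕ → LaurentSeries F} {x : ℕ → L}

namespace IsNearOneDim

lemma bLow_mono (hL : IsNearOneDim p n b β Ω ε x) {i j : ℕ} (hij : i ≤ j) (hj : j ≤ n) :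
    bLow p n b Ω i ≤ bLow p n b Ω j := by
  induction j, hij using Nat.le_induction with
  | base => exact le_rfl
  | succ j hij ih =>
    rw [bLow_succ]
    have := hL.m_nonneg hj
    have h2 : (0 : ℤ) ≤ p ^ (n + j + 1) * m Ω (j + 1) := by positivity
    linarith [ih (by omega)]

lemma bLow_pos (hL : IsNearOneDim p n b β Ω ε x) {j : ℕ} (hj : j ≤ n) : 0 < bLow p n b Ω j := by
  refine lt_of_lt_of_le ?_ (hL.bLow_mono (Nat.zero_le j) hj)
  rw [bLow_zero]
  exact_mod_cast hL.b_pos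

lemma bLow_isCoprime (hL : IsNearOneDim p n b β Ω ε x) (j : ℕ) :
    IsCoprime (bLow p n b Ω j) p := by
  induction j with
  | zero => rw [bLow_zero]; exact Nat.isCoprime_iff_coprime.2 hL.b_coprime
  | succ j ih =>
    rw [bLow_succ, pow_succ', mul_assoc]
    exact (IsCoprime.add_mul_left_left_iff (z := (p : ℤ) ^ (n + j) * m Ω (j + 1))).2 ih

/-- The bound on the `ε_j` is stable under the recursion, since
`errorBound j - errorBound i = v_K (φ^{n-i} (Ω_j^{(i)}))`. -/
lemma orderGT_errRec (hL : IsNearOneDim p n b β Ω ε x) {i : ℕ} :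
    ∀ {j : ℕ}, i ≤ j → j ≤ n → OrderGT (errorBound p n b Ω j) (errRec p n Ω ε i j) := by
  induction i with
  | zero =>
    intro j _ hj r hr
    have h := hL.ε_bound j hj (ne_zero_of_vK hr)
    rwa [show (ε j).order = r from order_of_vK hr] at h
  | succ i ih =>
    intro j hij hj
    refine (ih (by omega) hj).sub ?_
    rw [← errorBound_add b Ω (show i ≤ j by omega) hj]
    refine OrderGT.mul ?_ (ih le_rfl (by omega))
    rw [vK_pow (hL.vK_OmegaRec (by omega) hj)]
    congr 1
    rw [← mul_assoc]
    congr 1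
    push_cast
    rw [← pow_add]
    congr 1
    omega

lemma neg_bLow_le_errorBound (hL : IsNearOneDim p n b β Ω ε x) {j : ℕ} (hj : j ≤ n) :
    (-(bLow p n b Ω j) : ℚ) ≤ p ^ j * errorBound p n b Ω j := by
  have hp : (1 : ℚ) ≤ p := by exact_mod_cast (Fact.out : p.Prime).one_le
  have hpj : (p : ℚ) ^ j ≤ p ^ n := pow_le_pow_right₀ hp hj
  have hm : ∀ k ≤ n, (0 : ℚ) ≤ m Ω k := fun k hk => by exact_mod_cast hL.m_nonneg hk
  have h1 : (p : ℚ) ^ j * (b / p ^ n) ≤ b := by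
    rw [mul_div_assoc', div_le_iff₀ (by positivity), mul_comm (b : ℚ)]
    exact mul_le_mul_of_nonneg_right hpj (by positivity)
  have h2 : (0 : ℚ) ≤ ∑ k ∈ Icc 1 j, (p : ℚ) ^ k * (m Ω k : ℚ) :=
    sum_nonneg fun k hk => mul_nonneg (by positivity) (hm k ((mem_Icc.1 hk).2.trans hj))
  have h3 : (0 : ℚ) ≤ ∑ k ∈ Icc (j + 1) n, ((p : ℚ) ^ n - (p : ℚ) ^ k) * (m Ω k : ℚ) :=
    sum_nonneg fun k hk => mul_nonneg
      (sub_nonneg.2 (pow_le_pow_right₀ hp (mem_Icc.1 hk).2)) (hm k (mem_Icc.1 hk).2)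
  have h4 := mul_le_mul_of_nonneg_right hpj h2
  have h5 : (0 : ℚ) ≤ p ^ j * ∑ k ∈ Icc (j + 1) n, ((p : ℚ) ^ n - (p : ℚ) ^ k) * (m Ω k : ℚ) :=
    mul_nonneg (by positivity) h3
  rw [bLow, errorBound]
  push_cast
  rw [mul_add, mul_sub, mul_neg]
  linarith

/-- The error terms of the reduced equations are dominated by their main terms. -/
lemma neg_bLow_lt_vK_errRec (hL : IsNearOneDim p n b β Ω ε x) {j : ℕ} (hj : j ≤ n) {r : ℤ}
    (hr : vK F (errRec p n Ω ε j j) = r) : -(bLow p n b Ω j) < p ^ j * r := by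
  have h1 := hL.orderGT_errRec le_rfl hj r hr
  have h2 := hL.neg_bLow_le_errorBound hj
  have hp : (0 : ℚ) < p ^ j := pow_pos (by exact_mod_cast (Fact.out : p.Prime).pos) j
  have h3 := h2.trans_lt (mul_lt_mul_of_pos_left h1 hp)
  exact_mod_cast h3

end IsNearOneDim

end

/-! ### Valuations of the `X_j` in any extension of `v_K` -/

section

open Finset

variable {p n : ℕ} [Fact p.Prime] {F : Type*} [Field F]

/-- `w` restricts to a valuation of `K = F((t))` that is equivalent to `v_K`. -/
def ExtendsVK {M : Type*} [Field M] [Algebra (LaurentSeries F) M] {Γ₀ : Type*}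
    [LinearOrderedCommGroupWithZero Γ₀] (w : Valuation M Γ₀) : Prop :=
  ∀ a : LaurentSeries F, w (algebraMap _ M a) ≤ 1 ↔ 0 ≤ vK F a

variable (F) in
/-- The uniformizer `t` of `F((t))`. -/
def tK : LaurentSeries F := HahnSeries.single 1 1

lemma vK_tK : vK F (tK F) = ((1 : ℤ) : WithTop ℤ) := by
  rw [tK, HahnSeries.addVal_apply, HahnSeries.orderTop_single one_ne_zero]

lemma tK_ne_zero : tK F ≠ 0 := ne_zero_of_vK vK_tK

lemma vK_tK_zpow (r : ℤ) : vK F (tK F ^ r) = (r : WithTop ℤ) := by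
  obtain ⟨k, rfl | rfl⟩ := r.eq_nat_or_neg
  · have := vK_pow (vK_tK (F := F)) k
    rw [zpow_natCast, this, mul_one]
  · have h1 : vK F (1 : LaurentSeries F) = ((0 : ℤ) : WithTop ℤ) := by simp
    have := vK_div h1 (vK_pow (vK_tK (F := F)) k)
    rw [zpow_neg, zpow_natCast, ← one_div, this]
    congr 1
    ring

section Valuation

variable {M : Type*} [Field M] [Algebra (LaurentSeries F) M] {Γ₀ : Type*}
  [LinearOrderedCommGroupWithZero Γ₀] {w : Valuation M Γ₀}

namespace ExtendsVK

lemma val_tK_ne_zero (_hw : ExtendsVK (F := F) w) : w (algebraMap _ M (tK F)) ≠ 0 := by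
  simpa using tK_ne_zero (F := F)

lemma val_tK_lt_one (hw : ExtendsVK (F := F) w) : w (algebraMap _ M (tK F)) < 1 := by
  have h1 : ¬ w (algebraMap _ M (tK F ^ (-1 : ℤ))) ≤ 1 := by
    rw [hw, vK_tK_zpow, not_le]
    exact_mod_cast (by norm_num : (-1 : ℤ) < 0)
  rw [zpow_neg_one, map_inv₀, map_inv₀, not_le] at h1
  exact (one_lt_inv₀ (zero_lt_iff.2 hw.val_tK_ne_zero)).1 h1

lemma val_algebraMap (hw : ExtendsVK (F := F) w) {a : LaurentSeries F} {r : ℤ}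
    (ha : vK F a = r) : w (algebraMap _ M a) = w (algebraMap _ M (tK F)) ^ r := by
  have h1 : w (algebraMap _ M (a / tK F ^ r)) ≤ 1 := by
    rw [hw, vK_div ha (vK_tK_zpow r), sub_self]
    exact le_rfl
  have h2 : w (algebraMap _ M (tK F ^ r / a)) ≤ 1 := by
    rw [hw, vK_div (vK_tK_zpow r) ha, sub_self]
    exact le_rfl
  have ha0 : w (algebraMap _ M a) ≠ 0 := by simpa using ne_zero_of_vK ha
  have ht0 := zpow_ne_zero r hw.val_tK_ne_zero
  simp only [map_div₀, map_zpow₀] at h1 h2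
  exact le_antisymm ((div_le_one₀ (zero_lt_iff.2 ht0)).1 h1)
    ((div_le_one₀ (zero_lt_iff.2 ha0)).1 h2)

lemma zpow_lt_zpow (hw : ExtendsVK (F := F) w) {r s : ℤ} (h : r < s) :
    w (algebraMap _ M (tK F)) ^ s < w (algebraMap _ M (tK F)) ^ r :=
  zpow_lt_zpow_right_of_lt_one₀ (zero_lt_iff.2 hw.val_tK_ne_zero) hw.val_tK_lt_one h

lemma zpow_le_zpow_iff (hw : ExtendsVK (F := F) w) {r s : ℤ} :
    w (algebraMap _ M (tK F)) ^ s ≤ w (algebraMap _ M (tK F)) ^ r ↔ r ≤ s :=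
  zpow_le_zpow_iff_right_of_lt_one₀ (zero_lt_iff.2 hw.val_tK_ne_zero) hw.val_tK_lt_one

lemma zpow_inj (hw : ExtendsVK (F := F) w) {r s : ℤ}
    (h : w (algebraMap _ M (tK F)) ^ s = w (algebraMap _ M (tK F)) ^ r) : r = s :=
  le_antisymm (hw.zpow_le_zpow_iff.1 h.le) (hw.zpow_le_zpow_iff.1 h.ge)

end ExtendsVK

/-- If `℘ y` is not in the maximal ideal, then `w (y) ^ p = w (℘ y)`. -/
lemma val_pow_eq_of_one_le {y : M} (h : 1 ≤ w (y ^ p - y)) : w y ^ p = w (y ^ p - y) := by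
  have hp := (Fact.out : p.Prime).one_lt
  have hsub : w (y ^ p - y) ≤ max (w y ^ p) (w y) := by
    rw [← map_pow]
    exact w.map_sub _ _
  rcases lt_trichotomy (w y) 1 with hy | hy | hy
  · have h1 : w y ^ p < 1 := pow_lt_one₀ zero_le hy (by omega)
    exact absurd (hsub.trans_lt (max_lt h1 hy)) (not_lt.2 h)
  · rw [hy, one_pow, max_self] at hsub
    rw [hy, one_pow]
    exact le_antisymm h hsub
  · rw [Valuation.map_sub_eq_of_lt_left, map_pow]
    rw [map_pow]
    exact lt_self_pow₀ hy hp

/-- If `℘ y = T + e` with a main term `T` of negative valuation and an error `e ∈ K`, then the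
valuation of `y` is `1 / p` times that of `T`. -/
lemma ExtendsVK.val_of_dominant (hw : ExtendsVK (F := F) w) {y T : M} {e : LaurentSeries F}
    {j : ℕ} {c : ℤ} (hc : 0 < c) (h : y ^ p - y = T + algebraMap _ M e)
    (hT : w T ^ p ^ j = w (algebraMap _ M (tK F)) ^ (-c))
    (he : ∀ r : ℤ, vK F e = r → -c < p ^ j * r) :
    w y ^ p ^ (j + 1) = w (algebraMap _ M (tK F)) ^ (-c) := by
  have hpj : p ^ j ≠ 0 := pow_ne_zero _ (Fact.out : p.Prime).ne_zero
  have hT1 : 1 < w T := by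
    rw [← one_lt_pow_iff_of_nonneg zero_le hpj, hT, ← zpow_zero (w (algebraMap _ M (tK F)))]
    exact hw.zpow_lt_zpow (by omega)
  have heT : w (algebraMap _ M e) < w T := by
    by_cases he0 : e = 0
    · rw [he0, map_zero, map_zero]
      exact zero_lt_one.trans hT1
    · have h1 : vK F e = (e.order : ℤ) := HahnSeries.addVal_apply_of_ne he0
      rw [← pow_lt_pow_iff_left₀ zero_le zero_le hpj, hT, hw.val_algebraMap h1,
        ← zpow_natCast, ← zpow_mul]
      apply hw.zpow_lt_zpow
      rw [mul_comm]
      exact_mod_cast he _ h1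
  have hwp : w (y ^ p - y) = w T := by
    rw [h]
    exact w.map_add_eq_of_lt_left heT
  rw [pow_succ', pow_mul, val_pow_eq_of_one_le (by rw [hwp]; exact hT1.le), hwp, hT]

end Valuation

variable [Algebra (ZMod p) F] {L : Type*} [Field L] [Algebra (LaurentSeries F) L]
  {b : ℕ} {β : LaurentSeries F} {Ω ε : ℕ → LaurentSeries F} {x : ℕ → L}
  {M : Type*} [Field M] [Algebra (LaurentSeries F) M] {y : ℕ → M} {J : ℕ}

lemma charP_of_algebra (p : ℕ) [Fact p.Prime] (F : Type*) [Field F] [Algebra (ZMod p) F]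
    (M : Type*) [Field M] [Algebra (LaurentSeries F) M] : CharP M p :=
  have := charP_laurentSeries p F
  charP_of_injective_algebraMap (algebraMap (LaurentSeries F) M).injective p

/-- The coefficients of the reduced equations: `φ^{n-i-1} (℘ (Ω_j^{(i)}))` at index `i + 1`. -/
def mainCoeff (p n : ℕ) (Ω : ℕ → LaurentSeries F) (i j : ℕ) : LaurentSeries F :=
  (OmegaRec p Ω i j ^ p - OmegaRec p Ω i j) ^ p ^ (n - (i + 1))

lemma mainCoeff_eq (i j : ℕ) : mainCoeff p n Ω i j =
    (OmegaRec p Ω i j ^ p ^ (n - (i + 1))) ^ p - OmegaRec p Ω i j ^ p ^ (n - (i + 1)) := by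
  have := charP_laurentSeries p F
  rw [mainCoeff, sub_pow_char_pow, ← pow_mul, ← pow_mul, mul_comm]

/-- One reduction step: subtracting a multiple of `X` from `Y` cancels the main terms. -/
lemma wp_sub_mul [CharP M p] {X Y Z ω a e f : M} (hX : X ^ p - X = a * Z + e)
    (hY : Y ^ p - Y = ω ^ p * a * Z + f) :
    (Y - ω * X) ^ p - (Y - ω * X) = -(ω ^ p - ω) * X + (f - ω ^ p * e) := by
  rw [sub_pow_char, mul_pow]
  linear_combination hY - ω ^ p * hX

namespace IsNearOneDim

lemma vK_mainCoeff (hL : IsNearOneDim p n b β Ω ε x) {j : ℕ} (hj : j + 1 ≤ n) :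
    vK F (mainCoeff p n Ω j (j + 1)) = ((-(p ^ n * m Ω (j + 1)) : ℤ) : WithTop ℤ) := by
  rw [mainCoeff, vK_pow (hL.vK_wp_OmegaRec (Nat.lt_succ_self j) hj)]
  congr 1
  rw [← mul_assoc]
  push_cast
  rw [← pow_add, Nat.sub_add_cancel hj, m, Nat.add_sub_cancel]
  ring

/-- The Artin-Schreier equations satisfied by the `X_j^{(i)}`. -/
lemma wp_XRec (hL : IsNearOneDim p n b β Ω ε x) (hJ : J ≤ n)
    (hy : ∀ i ≤ J, y i ^ p - y i = algebraMap _ M (Ω i ^ p ^ n * β + ε i)) (i : ℕ) :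
    ∀ j, i + 1 ≤ j → j ≤ J →
      XRec p n Ω y (i + 1) j ^ p - XRec p n Ω y (i + 1) j =
        -(algebraMap _ M (mainCoeff p n Ω i j)) * XRec p n Ω y i i +
          algebraMap _ M (errRec p n Ω ε (i + 1) j) := by
  have := charP_of_algebra p F M
  have hpow : ∀ i j, i + 1 ≤ n → OmegaRec p Ω i j ^ p ^ (n - i) =
      (OmegaRec p Ω i j ^ p ^ (n - (i + 1))) ^ p := by
    intro i j hi
    rw [← pow_mul, ← pow_succ]
    congr 2
    omega
  induction i with
  | zero =>
    intro j hij hj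
    have hX : y 0 ^ p - y 0 = 1 * algebraMap _ M β + algebraMap _ M (ε 0) := by
      rw [hy 0 (Nat.zero_le _), hL.Ω_zero]
      simp
    have hY : y j ^ p - y j = (algebraMap _ M (OmegaRec p Ω 0 j ^ p ^ (n - (0 + 1)))) ^ p * 1 *
        algebraMap _ M β + algebraMap _ M (ε j) := by
      rw [hy j hj, ← map_pow, ← hpow 0 j (by omega), map_add, map_mul, mul_one]
      rfl
    have h := wp_sub_mul hX hY
    simp only [XRec, errRec, hpow 0 j (by omega), mainCoeff_eq] at h ⊢
    simpa using h
  | succ i ih =>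
    intro j hij hj
    have hX := ih (i + 1) le_rfl (by omega)
    have hY := ih j (by omega) hj
    have hden := ne_zero_of_vK (hL.vK_wp_OmegaRec (Nat.lt_succ_self i) (by omega))
    have hQ : mainCoeff p n Ω i j = (OmegaRec p Ω (i + 1) j ^ p ^ (n - (i + 1 + 1))) ^ p *
        mainCoeff p n Ω i (i + 1) := by
      rw [← hpow (i + 1) j (by omega), mainCoeff, mainCoeff, ← mul_pow, OmegaRec,
        div_mul_cancel₀ _ hden]
    rw [hQ, map_mul, map_pow, ← mul_neg] at hY
    have h := wp_sub_mul hX hY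
    simp only [XRec, errRec, hpow (i + 1) j (by omega), mainCoeff_eq] at h ⊢
    simpa using h

lemma wp_X_zero (hL : IsNearOneDim p n b β Ω ε x)
    (hy : ∀ i ≤ J, y i ^ p - y i = algebraMap _ M (Ω i ^ p ^ n * β + ε i)) :
    XRec p n Ω y 0 0 ^ p - XRec p n Ω y 0 0 = algebraMap _ M β + algebraMap _ M (ε 0) := by
  have h := hy 0 (Nat.zero_le _)
  rw [hL.Ω_zero, one_pow, one_mul, map_add] at h
  exact h

variable {Γ₀ : Type*} [LinearOrderedCommGroupWithZero Γ₀] {w : Valuation M Γ₀}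

/-- `v (X_j^{(j)}) = -b_(j) / p ^ (j+1)` for every extension `v` of `v_K`. -/
lemma val_X (hL : IsNearOneDim p n b β Ω ε x) (hJ : J ≤ n)
    (hy : ∀ i ≤ J, y i ^ p - y i = algebraMap _ M (Ω i ^ p ^ n * β + ε i))
    (hw : ExtendsVK (F := F) w) (j : ℕ) (hj : j ≤ J) :
    w (XRec p n Ω y j j) ^ p ^ (j + 1) = w (algebraMap _ M (tK F)) ^ (-(bLow p n b Ω j)) := by
  induction j with
  | zero =>
    refine hw.val_of_dominant (hL.bLow_pos (Nat.zero_le n)) (hL.wp_X_zero hy) ?_ ?_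
    · rw [bLow_zero, pow_zero, pow_one]
      exact hw.val_algebraMap hL.val_β
    · intro r hr
      exact hL.neg_bLow_lt_vK_errRec (Nat.zero_le n) hr
  | succ j ih =>
    refine hw.val_of_dominant (hL.bLow_pos (hj.trans hJ))
      (hL.wp_XRec hJ hy j (j + 1) le_rfl hj) ?_ ?_
    · rw [neg_mul, Valuation.map_neg, map_mul, mul_pow, ih (by omega),
        hw.val_algebraMap (hL.vK_mainCoeff (hj.trans hJ)), ← zpow_natCast, ← zpow_mul,
        ← zpow_add₀ hw.val_tK_ne_zero, bLow_succ]
      congr 1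
      push_cast
      ring
    · intro r hr
      exact hL.neg_bLow_lt_vK_errRec (hj.trans hJ) hr

/-- A sequence that satisfies the homogeneous parts of the reduced equations from index `i` on and
starts with a unit has `v (d_j) = (b_(i) - b_(j)) / p ^ (j+1)`. -/
lemma val_of_homogeneous (hL : IsNearOneDim p n b β Ω ε x) {d : ℕ → M} {i : ℕ}
    (hw : ExtendsVK (F := F) w) (hi : w (d i) = 1)
    (hd : ∀ j, i ≤ j → j + 1 ≤ n → d (j + 1) ^ p - d (j + 1) =
      -(algebraMap _ M (mainCoeff p n Ω j (j + 1))) * d j) (j : ℕ) (hij : i ≤ j) (hj : j ≤ n) :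
    w (d j) ^ p ^ (j + 1) =
      w (algebraMap _ M (tK F)) ^ (bLow p n b Ω i - bLow p n b Ω j) := by
  induction j, hij using Nat.le_induction with
  | base => simp [hi]
  | succ j hij ih =>
    have hpj : p ^ (j + 1) ≠ 0 := pow_ne_zero _ (Fact.out : p.Prime).ne_zero
    have h1 : w (d (j + 1) ^ p - d (j + 1)) ^ p ^ (j + 1) =
        w (algebraMap _ M (tK F)) ^ (bLow p n b Ω i - bLow p n b Ω (j + 1)) := by
      rw [hd j hij hj, neg_mul, Valuation.map_neg, map_mul, mul_pow, ih (by omega),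
        hw.val_algebraMap (hL.vK_mainCoeff hj), ← zpow_natCast, ← zpow_mul,
        ← zpow_add₀ hw.val_tK_ne_zero, bLow_succ]
      congr 1
      push_cast
      ring
    have h2 : 1 ≤ w (d (j + 1) ^ p - d (j + 1)) := by
      rw [← one_le_pow_iff_of_nonneg zero_le hpj, h1, ← zpow_zero (w (algebraMap _ M (tK F))),
        hw.zpow_le_zpow_iff]
      linarith [hL.bLow_mono (show i ≤ j + 1 by omega) hj]
    rw [pow_succ', pow_mul, val_pow_eq_of_one_le h2, h1]

end IsNearOneDim

end

/-! ### Valuation rings over the valuation ring of `F((t))` -/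

section

open Finset

variable {p n : ℕ} [Fact p.Prime] {F : Type*} [Field F]

section AddValuation

variable {M : Type*} [Field M]

lemma addVal_add_inv (w : AddValuation M (WithTop ℤ)) {z : M} (hz : z ≠ 0) : w z + w z⁻¹ = 0 := by
  rw [← w.map_mul, mul_inv_cancel₀ hz, w.map_one]

/-- The valuation ring of an additive valuation. -/
def ringOfAddVal (w : AddValuation M (WithTop ℤ)) : ValuationSubring M where
  carrier := {z | 0 ≤ w z}
  mul_mem' {a c} ha hc := by
    simp only [Set.mem_ofPred_eq, w.map_mul] at *
    exact add_nonneg ha hc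
  one_mem' := by simp
  add_mem' {a c} ha hc := w.map_le_add ha hc
  zero_mem' := by simp
  neg_mem' {a} ha := by simpa [w.map_neg] using ha
  mem_or_inv_mem' z := by
    by_cases hz : z = 0
    · left; simp [hz]
    · by_contra! h
      simp only [Set.mem_ofPred_eq, not_le] at h
      have h1 := addVal_add_inv w hz
      obtain ⟨r, hr⟩ := exists_int_of_ne_zero w hz
      obtain ⟨s, hs⟩ := exists_int_of_ne_zero w (inv_ne_zero hz)
      rw [hr, hs] at h h1
      have h2 : r + s = 0 := by exact_mod_cast h1
      have h3 : r < 0 := by exact_mod_cast h.1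
      have h4 : s < 0 := by exact_mod_cast h.2
      omega

lemma mem_ringOfAddVal {w : AddValuation M (WithTop ℤ)} {z : M} :
    z ∈ ringOfAddVal w ↔ 0 ≤ w z := Iff.rfl

lemma addVal_eq_zero_of_val_eq_one {w : AddValuation M (WithTop ℤ)} {z : M}
    (h : (ringOfAddVal w).valuation z = 1) : w z = 0 := by
  have hz : z ≠ 0 := by
    rintro rfl
    simp at h
  have h1 : 0 ≤ w z := (ValuationSubring.valuation_le_one_iff _ _).1 h.le
  have h2 : 0 ≤ w z⁻¹ := by
    refine (ValuationSubring.valuation_le_one_iff (ringOfAddVal w) _).1 ?_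
    rw [map_inv₀, h, inv_one]
  have h3 := addVal_add_inv w hz
  refine le_antisymm ?_ h1
  rw [← h3]
  exact le_add_of_nonneg_right h2

end AddValuation

section Extension

variable {M : Type*} [Field M] [Algebra (LaurentSeries F) M]

lemma extendsVK_of_restrict {w : AddValuation M (WithTop ℤ)} {e : ℕ} (he : 0 < e)
    (hw : ∀ a : LaurentSeries F, w (algebraMap _ M a) = e • vK F a) :
    ExtendsVK (F := F) (ringOfAddVal w).valuation := by
  intro a
  rw [ValuationSubring.valuation_le_one_iff, mem_ringOfAddVal, hw]
  by_cases ha : a = 0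
  · subst ha
    obtain ⟨k, rfl⟩ := Nat.exists_eq_succ_of_ne_zero he.ne'
    simp [succ_nsmul]
  · rw [HahnSeries.addVal_apply_of_ne ha, nsmul_coe]
    have : 0 ≤ (e : ℤ) * a.order ↔ 0 ≤ a.order := by
      constructor
      · intro h
        exact nonneg_of_mul_nonneg_right h (by exact_mod_cast he)
      · intro h
        positivity
    exact_mod_cast this

/-- An exponent with respect to the valuation ring of `w` is an exponent with respect to `w`. -/
lemma nsmul_addVal_eq {w : AddValuation M (WithTop ℤ)} {e : ℕ} (he : 0 < e)
    (hw : ∀ a : LaurentSeries F, w (algebraMap _ M a) = e • vK F a) {z : M} {N : ℕ} {r : ℤ}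
    (h : (ringOfAddVal w).valuation z ^ N =
      (ringOfAddVal w).valuation (algebraMap _ M (tK F)) ^ r) :
    N • w z = ((e * r : ℤ) : WithTop ℤ) := by
  have hA := extendsVK_of_restrict he hw
  have ht0 : algebraMap _ M (tK F ^ r) ≠ 0 := 
    (map_ne_zero _).2 (zpow_ne_zero r tK_ne_zero)
  have h1 : (ringOfAddVal w).valuation (z ^ N / algebraMap _ M (tK F ^ r)) = 1 := by
    rw [map_div₀, map_pow, h, map_zpow₀, map_zpow₀, div_self (zpow_ne_zero r hA.val_tK_ne_zero)]
  have h2 := addVal_eq_zero_of_val_eq_one h1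
  have h3 : w (z ^ N) = w (algebraMap _ M (tK F ^ r)) := by
    conv_lhs => rw [← div_mul_cancel₀ (z ^ N) ht0]
    rw [w.map_mul, h2, zero_add]
  rw [← w.map_pow, h3, hw, vK_tK_zpow, nsmul_coe]

variable (F M) in
/-- Every extension field of `K` has a valuation ring that lies over the one of `K`. -/
lemma exists_extendsVK : ∃ A : ValuationSubring M, ExtendsVK (F := F) A.valuation := by
  obtain ⟨A, hA, hloc⟩ := IsLocalRing.exists_factor_valuationRing
    ((algebraMap (LaurentSeries F) M).comp (ringOfAddVal (vK F)).subtype)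
  refine ⟨A, fun a => ?_⟩
  rw [ValuationSubring.valuation_le_one_iff]
  constructor
  · intro ha
    by_contra hneg
    have ha0 : a ≠ 0 := by
      rintro rfl
      simp at hneg
    have hinv : a⁻¹ ∈ ringOfAddVal (vK F) :=
      ((ringOfAddVal (vK F)).mem_or_inv_mem a).resolve_left hneg
    have hu : IsUnit (⟨a⁻¹, hinv⟩ : ringOfAddVal (vK F)) := by
      apply hloc.map_nonunit
      refine IsUnit.of_mul_eq_one (⟨algebraMap _ M a, ha⟩ : A.toSubring) ?_
      ext
      change algebraMap _ M a⁻¹ * algebraMap _ M a = 1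
      rw [← map_mul, inv_mul_cancel₀ ha0, map_one]
    obtain ⟨⟨c, hc⟩, hc1⟩ := hu.exists_right_inv
    have h1 : a⁻¹ * c = 1 := congrArg Subtype.val hc1
    have h2 : c = a := by
      field_simp at h1
      exact h1
    exact hneg (h2 ▸ hc)
  · intro ha
    exact hA ⟨a, ha⟩

end Extension

/-- Among the values `N r_k - k b` with `k < N` and `b` prime to `N`, there is exactly one smallest,
since they are distinct modulo `N`. -/
lemma exists_strict_min {N : ℕ} {c : ℤ} (hc : IsCoprime c N) {T : Finset ℕ} (hT : T.Nonempty)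
    (hTN : ∀ k ∈ T, k < N) (r : ℕ → ℤ) :
    ∃ k₀ ∈ T, ∀ k ∈ T, k ≠ k₀ → N * r k₀ - k₀ * c < N * r k - k * c := by
  obtain ⟨k₀, hk₀, hmin⟩ := T.exists_min_image (fun k => (N : ℤ) * r k - k * c) hT
  refine ⟨k₀, hk₀, fun k hk hne => lt_of_le_of_ne (hmin k hk) fun heq => hne ?_⟩
  have h1 : (N : ℤ) ∣ ((k : ℤ) - k₀) * c := ⟨r k - r k₀, by linear_combination heq⟩
  have h2 : (N : ℤ) ∣ (k : ℤ) - k₀ := hc.symm.dvd_of_dvd_mul_right h1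
  have h3 := Int.eq_zero_of_abs_lt_dvd h2 (by
    have := hTN k hk
    have := hTN k₀ hk₀
    rw [abs_lt]
    omega)
  omega

/-- If `X ^ p - X` lies in `S`, then `S(X)` is spanned over `S` by `X ^ k` with `k < p`. -/
lemma exists_eq_sum_pow {K M : Type*} [Field K] [Field M] [Algebra K M]
    (S : IntermediateField K M) {X : M} (hX : X ^ p - X ∈ S) {z : M}
    (hz : z ∈ IntermediateField.adjoin S {X}) :
    ∃ s : ℕ → M, (∀ k, s k ∈ S) ∧ z = ∑ k ∈ range p, s k * X ^ k := by
  classical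
  have hp := (Fact.out : p.Prime).one_lt
  let f : Polynomial S := Polynomial.X ^ p - Polynomial.X - Polynomial.C ⟨X ^ p - X, hX⟩
  have hdeg : (Polynomial.X + Polynomial.C ⟨X ^ p - X, hX⟩ : Polynomial S).degree < p := by
    rw [Polynomial.degree_X_add_C]
    exact_mod_cast hp
  have hf : f.Monic := by
    have : f = Polynomial.X ^ p - (Polynomial.X + Polynomial.C ⟨X ^ p - X, hX⟩) := by
      simp only [f]; ring
    rw [this]
    exact Polynomial.monic_X_pow_sub hdeg
  have hfd : f.natDegree = p := by
    have : f = Polynomial.X ^ p - (Polynomial.X + Polynomial.C ⟨X ^ p - X, hX⟩) := by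
      simp only [f]; ring
    rw [this, Polynomial.natDegree_sub_eq_left_of_natDegree_lt]
    · simp
    · rw [Polynomial.natDegree_X_add_C, Polynomial.natDegree_X_pow]
      exact hp
  have hroot : Polynomial.aeval X f = 0 := by
    simp [f]
  have halg : IsAlgebraic S X := ⟨f, hf.ne_zero, hroot⟩
  have hz' : z ∈ Algebra.adjoin S {X} := by
    rw [← IntermediateField.adjoin_simple_toSubalgebra_of_isAlgebraic halg]
    exact hz
  rw [Algebra.adjoin_singleton_eq_range_aeval] at hz'
  obtain ⟨q, rfl⟩ := hz'
  refine ⟨fun k => ((q %ₘ f).coeff k : M), fun k => ((q %ₘ f).coeff k).2, ?_⟩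
  have hq : Polynomial.aeval X q = Polynomial.aeval X (q %ₘ f) := by
    conv_lhs => rw [← Polynomial.modByMonic_add_div q f]
    rw [map_add, map_mul, hroot, zero_mul, add_zero]
  have hlt : (q %ₘ f).natDegree < p := by
    have h1 := Polynomial.natDegree_modByMonic_lt q hf (by
      intro h
      rw [h] at hfd
      simp at hfd
      omega)
    rwa [hfd] at h1
  change Polynomial.aeval X q = _
  rw [hq, Polynomial.aeval_eq_sum_range' hlt]
  rfl

end

/-! ### Existence and uniqueness of the normalized valuations -/

section

open Finset

variable {p n : ℕ} [Fact p.Prime] {F : Type*} [Field F]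
  {M : Type*} [Field M] [Algebra (LaurentSeries F) M] {y : ℕ → M} {J : ℕ}

lemma XRec_mem {S : IntermediateField (LaurentSeries F) M} {Ω : ℕ → LaurentSeries F} (i : ℕ) :
    ∀ j, i ≤ j → (∀ l ≤ j, y l ∈ S) → XRec p n Ω y i j ∈ S := by
  induction i with
  | zero => exact fun j _ h => h j le_rfl
  | succ i ih =>
    intro j hij h
    exact S.sub_mem (ih j (by omega) h)
      (S.mul_mem (S.algebraMap_mem _) (ih i le_rfl fun l hl => h l (by omega)))

lemma sub_XRec_mem {S : IntermediateField (LaurentSeries F) M} {Ω : ℕ → LaurentSeries F} (i : ℕ) :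
    ∀ j, i ≤ j → (∀ l < j, y l ∈ S) → y j - XRec p n Ω y i j ∈ S := by
  induction i with
  | zero =>
    intro j _ _
    simp [XRec]
  | succ i ih =>
    intro j hij h
    have h1 := S.add_mem (ih j (by omega) h)
      (S.mul_mem (S.algebraMap_mem (OmegaRec p Ω i j ^ p ^ (n - (i + 1))))
        (XRec_mem (p := p) (n := n) (Ω := Ω) i i le_rfl fun l hl => h l (by omega)))
    rw [XRec]
    convert h1 using 1
    ring

lemma map_XRec {M' : Type*} [Field M'] [Algebra (LaurentSeries F) M']
    (f : M →ₐ[LaurentSeries F] M') (Ω : ℕ → LaurentSeries F) {y' : ℕ → M'} (i : ℕ) :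
    ∀ j, i ≤ j → (∀ l ≤ j, f (y l) = y' l) → f (XRec p n Ω y i j) = XRec p n Ω y' i j := by
  induction i with
  | zero => exact fun j _ h => h j le_rfl
  | succ i ih =>
    intro j hij h
    rw [XRec, XRec, map_sub, map_mul, AlgHom.commutes, ih j (by omega) h,
      ih i le_rfl fun l hl => h l (by omega)]

variable [Algebra (ZMod p) F] {L : Type*} [Field L] [Algebra (LaurentSeries F) L]
  {b : ℕ} {β : LaurentSeries F} {Ω ε : ℕ → LaurentSeries F} {x : ℕ → L}

namespace IsNearOneDim

lemma wp_X_mem (hL : IsNearOneDim p n b β Ω ε x) (hJ : J ≤ n)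
    (hy : ∀ i ≤ J, y i ^ p - y i = algebraMap _ M (Ω i ^ p ^ n * β + ε i)) {j : ℕ} (hj : j ≤ J)
    {S : IntermediateField (LaurentSeries F) M} (hS : ∀ l < j, y l ∈ S) :
    XRec p n Ω y j j ^ p - XRec p n Ω y j j ∈ S := by
  rcases j with _ | j
  · rw [hL.wp_X_zero hy]
    exact S.add_mem (S.algebraMap_mem _) (S.algebraMap_mem _)
  · rw [hL.wp_XRec hJ hy j (j + 1) le_rfl hj]
    exact S.add_mem (S.mul_mem (S.neg_mem (S.algebraMap_mem _))
      (XRec_mem j j le_rfl fun l hl => hS l (by omega))) (S.algebraMap_mem _)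

lemma bLow_isCoprime_pow (hL : IsNearOneDim p n b β Ω ε x) (j k : ℕ) :
    IsCoprime (bLow p n b Ω j) ((p ^ k : ℕ) : ℤ) := by
  rw [Nat.cast_pow]
  exact (hL.bLow_isCoprime j).pow_right

/-- The value of an element of `K(y_0, …, y_{i-1})` is the same for all valuation rings over `𝔒_K`:
write it as a polynomial in `X_{i-1}` of degree below `p`, whose terms have distinct values modulo
the values of the smaller field. -/
lemma exists_exponent (hL : IsNearOneDim p n b β Ω ε x) (hJ : J ≤ n)
    (hy : ∀ i ≤ J, y i ^ p - y i = algebraMap _ M (Ω i ^ p ^ n * β + ε i)) (i : ℕ)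
    (hi : i ≤ J + 1) :
    ∀ z ∈ IntermediateField.adjoin (LaurentSeries F) (y '' Set.Iio i), z ≠ 0 →
      ∃ r : ℤ, ∀ A : ValuationSubring M, ExtendsVK (F := F) A.valuation →
        A.valuation z ^ p ^ i = A.valuation (algebraMap _ M (tK F)) ^ r := by
  classical
  induction i with
  | zero =>
    intro z hz hz0
    have h0 : y '' Set.Iio 0 = ∅ := by simp
    rw [h0, IntermediateField.adjoin_empty, IntermediateField.mem_bot] at hz
    obtain ⟨a, rfl⟩ := hz
    refine ⟨a.order, fun A hA => ?_⟩
    rw [pow_zero, pow_one]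
    exact hA.val_algebraMap (HahnSeries.addVal_apply_of_ne ((map_ne_zero _).1 hz0))
  | succ i ih =>
    intro z hz hz0
    set S := IntermediateField.adjoin (LaurentSeries F) (y '' Set.Iio i) with hS
    have hyS : ∀ l < i, y l ∈ S := fun l hl =>
      IntermediateField.subset_adjoin _ _ ⟨l, hl, rfl⟩
    set X := XRec p n Ω y i i with hX
    have hzX : z ∈ IntermediateField.adjoin S {X} := by
      have hle : IntermediateField.adjoin (LaurentSeries F) (y '' Set.Iio (i + 1)) ≤
          (IntermediateField.adjoin S {X}).restrictScalars (LaurentSeries F) := by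
        rw [IntermediateField.adjoin_le_iff]
        rintro _ ⟨l, hl, rfl⟩
        have hSX : ∀ u ∈ S, u ∈ IntermediateField.adjoin S {X} := fun u hu =>
          (IntermediateField.adjoin S {X}).algebraMap_mem ⟨u, hu⟩
        rcases Nat.lt_succ_iff_lt_or_eq.1 hl with hl | rfl
        · exact hSX _ (hyS l hl)
        · have h1 := hSX _ (sub_XRec_mem (p := p) (n := n) (Ω := Ω) l l le_rfl hyS)
          have h2 := (IntermediateField.adjoin S {X}).add_mem h1
            (IntermediateField.mem_adjoin_simple_self S X)
          rwa [sub_add_cancel] at h2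
      exact hle hz
    obtain ⟨s, hs, rfl⟩ := exists_eq_sum_pow S (hL.wp_X_mem hJ hy (by omega) hyS) hzX
    have hr : ∀ k, ∃ r : ℤ, s k ≠ 0 → ∀ A : ValuationSubring M, ExtendsVK (F := F) A.valuation →
        A.valuation (s k) ^ p ^ i = A.valuation (algebraMap _ M (tK F)) ^ r := by
      intro k
      by_cases hk : s k = 0
      · exact ⟨0, fun h => absurd hk h⟩
      · obtain ⟨r, h⟩ := ih (by omega) (s k) (hs k) hk
        exact ⟨r, fun _ => h⟩
    choose r hr using hr
    set T := (range p).filter fun k => s k ≠ 0 with hT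
    have hsum : ∑ k ∈ range p, s k * X ^ k = ∑ k ∈ T, s k * X ^ k := by
      symm
      apply sum_subset (filter_subset _ _)
      intro k hk hkT
      have : s k = 0 := by
        by_contra h
        exact hkT (mem_filter.2 ⟨hk, h⟩)
      rw [this, zero_mul]
    rw [hsum] at hz0 ⊢
    have hTne : T.Nonempty := by
      rw [nonempty_iff_ne_empty]
      intro h
      rw [h, sum_empty] at hz0
      exact hz0 rfl
    obtain ⟨k₀, hk₀, hmin⟩ := exists_strict_min (hL.bLow_isCoprime i) hTne
      (fun k hk => mem_range.1 (mem_filter.1 hk).1) r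
    refine ⟨p * r k₀ - k₀ * bLow p n b Ω i, fun A hA => ?_⟩
    have hterm : ∀ k ∈ T, A.valuation (s k * X ^ k) ^ p ^ (i + 1) =
        A.valuation (algebraMap _ M (tK F)) ^ (p * r k - k * bLow p n b Ω i) := by
      intro k hk
      rw [map_mul, map_pow, mul_pow, ← pow_mul, mul_comm k, pow_mul, hX,
        hL.val_X hJ hy hA i (by omega), pow_succ, pow_mul, hr k (mem_filter.1 hk).2 A hA,
        ← zpow_natCast, ← zpow_natCast, ← zpow_mul, ← zpow_mul, ← zpow_add₀ hA.val_tK_ne_zero]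
      congr 1
      ring
    rw [Valuation.map_sum_eq_of_lt _ hk₀, hterm k₀ hk₀]
    intro k hk
    rw [mem_sdiff, mem_singleton] at hk
    have hpi : p ^ (i + 1) ≠ 0 := pow_ne_zero _ (Fact.out : p.Prime).ne_zero
    rw [← pow_lt_pow_iff_left₀ zero_le zero_le hpi, hterm k hk.1, hterm k₀ hk₀]
    exact hA.zpow_lt_zpow (hmin k hk.1 hk.2)

/-- Existence and uniqueness of the normalized valuation, and its values on `K` and at `X_J`. -/
theorem exists_normalized (hL : IsNearOneDim p n b β Ω ε x) (hJ : J ≤ n)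
    (hy : ∀ i ≤ J, y i ^ p - y i = algebraMap _ M (Ω i ^ p ^ n * β + ε i))
    (hgen : IntermediateField.adjoin (LaurentSeries F) (y '' Set.Iic J) = ⊤) :
    ∃ w : AddValuation M (WithTop ℤ), IsNormalizedExtension F M w ∧
      (∀ w', IsNormalizedExtension F M w' → w' = w) ∧
      (∀ a : LaurentSeries F, w (algebraMap _ M a) = p ^ (J + 1) • vK F a) ∧
      w (XRec p n Ω y J J) = ((-(bLow p n b Ω J) : ℤ) : WithTop ℤ) := by
  classical
  have hq : 0 < p ^ (J + 1) := pow_pos (Fact.out : p.Prime).pos _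
  have hex : ∀ z : M, ∃ r : ℤ, z ≠ 0 → ∀ A : ValuationSubring M,
      ExtendsVK (F := F) A.valuation →
        A.valuation z ^ p ^ (J + 1) = A.valuation (algebraMap _ M (tK F)) ^ r := by
    intro z
    by_cases hz : z = 0
    · exact ⟨0, fun h => absurd hz h⟩
    · obtain ⟨r, hr⟩ := hL.exists_exponent hJ hy (J + 1) le_rfl z (by
        have : Set.Iio (J + 1) = Set.Iic J := by ext; simp
        rw [this, hgen]
        trivial) hz
      exact ⟨r, fun _ => hr⟩
  choose r hr using hex
  obtain ⟨A, hA⟩ := exists_extendsVK F M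
  have hrA : ∀ {z : M} {s : ℤ}, z ≠ 0 → A.valuation z ^ p ^ (J + 1) =
      A.valuation (algebraMap _ M (tK F)) ^ s → r z = s := fun hz h =>
    hA.zpow_inj (h.symm.trans (hr _ hz A hA))
  let w : AddValuation M (WithTop ℤ) := AddValuation.of (fun z => if z = 0 then ⊤ else (r z : ℤ))
    (if_pos rfl)
    (by
      rw [if_neg one_ne_zero, hrA (s := 0) one_ne_zero (by simp)]
      rfl)
    (by
      intro u v
      by_cases hu : u = 0
      · simp [hu]
      by_cases hv : v = 0
      · simp [hv]
      by_cases huv : u + v = 0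
      · simp [huv]
      rw [if_neg hu, if_neg hv, if_neg huv]
      have h1 := A.valuation.map_add u v
      have key : ∀ z, z ≠ 0 → A.valuation (u + v) ≤ A.valuation z → r z ≤ r (u + v) := by
        intro z hz h
        rw [← pow_le_pow_iff_left₀ zero_le zero_le hq.ne', hr _ hz A hA, hr _ huv A hA,
          hA.zpow_le_zpow_iff] at h
        exact h
      rcases le_max_iff.1 h1 with h | h
      · exact min_le_of_left_le (by exact_mod_cast key u hu h)
      · exact min_le_of_right_le (by exact_mod_cast key v hv h))
    (by
      intro u v
      by_cases hu : u = 0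
      · simp [hu]
      by_cases hv : v = 0
      · simp [hv]
      rw [if_neg hu, if_neg hv, if_neg (mul_ne_zero hu hv), ← WithTop.coe_add,
        hrA (mul_ne_zero hu hv)]
      rw [map_mul, mul_pow, hr u hu A hA, hr v hv A hA, ← zpow_add₀ hA.val_tK_ne_zero])
  have hw : ∀ z, z ≠ 0 → w z = (r z : ℤ) := fun z hz => if_neg hz
  have hwK : ∀ a : LaurentSeries F, w (algebraMap _ M a) = p ^ (J + 1) • vK F a := by
    intro a
    by_cases ha : a = 0
    · obtain ⟨k, hk⟩ := Nat.exists_eq_succ_of_ne_zero hq.ne'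
      simp [ha, hk, succ_nsmul]
    · have h0 : algebraMap _ M a ≠ 0 := (map_ne_zero _).2 ha
      have h1 : vK F a = (a.order : ℤ) := HahnSeries.addVal_apply_of_ne ha
      rw [hw _ h0, h1, nsmul_coe, hrA h0]
      rw [hA.val_algebraMap h1, mul_comm, zpow_mul, zpow_natCast]
  have hX := hL.val_X hJ hy hA J le_rfl
  have hX0 : XRec p n Ω y J J ≠ 0 := by
    intro h
    rw [h, map_zero, zero_pow hq.ne'] at hX
    exact zpow_ne_zero _ hA.val_tK_ne_zero hX.symm
  have hwX : w (XRec p n Ω y J J) = ((-(bLow p n b Ω J) : ℤ) : WithTop ℤ) := by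
    rw [hw _ hX0, hrA hX0 hX]
  -- a suitable product of powers of `X_J` and `t` has any prescribed value
  have hsurj : Function.Surjective w := by
    intro g
    induction g using WithTop.recTopCoe with
    | top => exact ⟨0, w.map_zero⟩
    | coe g =>
      obtain ⟨u, v, huv⟩ := hL.bLow_isCoprime_pow J (J + 1)
      have hX1 : XRec p n Ω y J J ^ (-(u * g)) ≠ 0 := zpow_ne_zero _ hX0
      have ht1 : algebraMap _ M (tK F ^ (v * g)) ≠ 0 :=
        (map_ne_zero _).2 (zpow_ne_zero _ tK_ne_zero)
      refine ⟨XRec p n Ω y J J ^ (-(u * g)) * algebraMap _ M (tK F ^ (v * g)), ?_⟩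
      rw [hw _ (mul_ne_zero hX1 ht1), hrA (mul_ne_zero hX1 ht1) (s := g)]
      rw [map_mul, mul_pow, map_zpow₀, ← zpow_natCast, ← zpow_natCast, zpow_comm, zpow_natCast, hX,
        hA.val_algebraMap (vK_tK_zpow _), ← zpow_mul, ← zpow_mul, ← zpow_add₀ hA.val_tK_ne_zero]
      congr 1
      linear_combination g * huv
  refine ⟨w, ⟨hsurj, p ^ (J + 1), hq, hwK⟩, ?_, hwK, hwX⟩
  rintro w' ⟨hsurj', e, he, hwK'⟩
  have hprop : ∀ z, z ≠ 0 → p ^ (J + 1) • w' z = ((e * r z : ℤ) : WithTop ℤ) := fun z hz =>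
    nsmul_addVal_eq he hwK' (hr z hz _ (extendsVK_of_restrict he hwK'))
  have hprop' : ∀ z s, z ≠ 0 → w' z = (s : ℤ) → (p ^ (J + 1) : ℕ) * s = e * r z := by
    intro z s hz hs
    have h := hprop z hz
    rw [hs, nsmul_coe] at h
    exact_mod_cast h
  -- both valuations are onto, hence the factor between them is `1`
  have he' : e = p ^ (J + 1) := by
    apply Nat.dvd_antisymm
    · obtain ⟨z, hz⟩ := hsurj' ((1 : ℤ) : WithTop ℤ)
      have hz0 : z ≠ 0 := by
        rintro rfl
        simp at hz
      have h := hprop' z 1 hz0 hz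
      rw [mul_one] at h
      exact Int.natCast_dvd_natCast.1 ⟨_, h⟩
    · obtain ⟨z, hz⟩ := hsurj ((1 : ℤ) : WithTop ℤ)
      have hz0 : z ≠ 0 := by
        rintro rfl
        simp at hz
      obtain ⟨s, hs⟩ := exists_int_of_ne_zero w' hz0
      have h := hprop' z s hz0 hs
      rw [hw _ hz0] at hz
      have h1 : r z = 1 := by exact_mod_cast hz
      rw [h1, mul_one] at h
      exact Int.natCast_dvd_natCast.1 ⟨_, h.symm⟩
  apply AddValuation.ext
  intro z
  by_cases hz : z = 0
  · rw [hz, w.map_zero, w'.map_zero]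
  · obtain ⟨s, hs⟩ := exists_int_of_ne_zero w' hz
    have h := hprop' z s hz hs
    rw [he'] at h
    rw [hs, hw z hz]
    have h2 : s = r z := mul_left_cancel₀ (by exact_mod_cast hq.ne') h
    rw [h2]

end IsNearOneDim

end

/-! ### Artin-Schreier extensions and powers of an element of value prime to `p` -/

section

open Finset Polynomial

variable {p n : ℕ} [Fact p.Prime] {F : Type*} [Field F]

section ArtinSchreier

variable {K L : Type*} [Field K] [Field L] [Algebra K L] [Algebra (ZMod p) L]

lemma charP_of_algebra_zmod (p : ℕ) [Fact p.Prime] (L : Type*) [Field L] [Algebra (ZMod p) L] :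
    CharP L p :=
  charP_of_injective_algebraMap (algebraMap (ZMod p) L).injective p

/-- The solutions of `c ^ p = c` are the elements of the prime field. -/
lemma exists_zmod_of_pow_eq {c : L} (hc : c ^ p = c) : ∃ a : ZMod p, algebraMap (ZMod p) L a = c := by
  have h := pow_sub_self_eq_prod (p := p) c
  rw [hc, sub_self, eq_comm, prod_eq_zero_iff] at h
  obtain ⟨a, -, ha⟩ := h
  exact ⟨a, (sub_eq_zero.1 ha).symm⟩

/-- The roots of an Artin-Schreier polynomial are the translates of one root by `𝔽_p`. -/
lemma map_artinSchreier_eq_prod {z : L} {c : K} (hz : z ^ p - z = algebraMap K L c) :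
    (X ^ p - X - C c : K[X]).map (algebraMap K L) =
      ∏ a : ZMod p, (X - C (z + algebraMap (ZMod p) L a)) := by
  have := charP_of_algebra_zmod p L
  have h := pow_sub_self_eq_prod (p := p) (X - C z : L[X])
  rw [sub_pow_char] at h
  have h1 : ∀ a : ZMod p, (X - C (z + algebraMap (ZMod p) L a) : L[X]) =
      X - C z - algebraMap (ZMod p) L[X] a := by
    intro a
    rw [Polynomial.algebraMap_apply, C_add]
    ring
  simp only [h1]
  rw [← h]
  simp only [Polynomial.map_sub, Polynomial.map_pow, map_X, map_C, ← hz, C_sub, C_pow]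
  ring

lemma artinSchreier_separable [CharP K p] (c : K) : (X ^ p - X - C c : K[X]).Separable := by
  rw [separable_def]
  have : derivative (X ^ p - X - C c : K[X]) = -1 := by
    simp [derivative_X_pow]
  rw [this]
  exact isCoprime_one_right.neg_right

lemma artinSchreier_ne_zero [CharP K p] (c : K) : (X ^ p - X - C c : K[X]) ≠ 0 :=
  (artinSchreier_separable (p := p) c).ne_zero

lemma aeval_artinSchreier {z : L} {c : K} (hz : z ^ p - z = algebraMap K L c) :
    aeval z (X ^ p - X - C c : K[X]) = 0 := by
  simp [hz]

/-- An extension generated by finitely many roots of Artin-Schreier equations is finite Galois. -/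
lemma isGalois_of_artinSchreier [CharP K p] {S : Set L} (hfin : S.Finite)
    (hS : ∀ z ∈ S, ∃ c : K, z ^ p - z = algebraMap K L c)
    (hgen : IntermediateField.adjoin K S = ⊤) :
    FiniteDimensional K L ∧ IsGalois K L := by
  have hint : ∀ z ∈ S, IsIntegral K z := fun z hz => by
    obtain ⟨c, hc⟩ := hS z hz
    exact IsAlgebraic.isIntegral ⟨_, artinSchreier_ne_zero (p := p) c, aeval_artinSchreier hc⟩
  have hmem : ∀ z : L, z ∈ IntermediateField.adjoin K S := fun z => hgen ▸ trivial
  have hfd : FiniteDimensional K L := by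
    have := hfin.to_subtype
    have h := IntermediateField.finiteDimensional_adjoin hint
    rw [hgen] at h
    exact Module.Finite.equiv (IntermediateField.topEquiv (F := K) (E := L)).toLinearEquiv
  have hsep : Algebra.IsSeparable K L := by
    have h : Algebra.IsSeparable K (IntermediateField.adjoin K S) := by
      rw [IntermediateField.isSeparable_adjoin_iff_isSeparable]
      intro z hz
      obtain ⟨c, hc⟩ := hS z hz
      exact (artinSchreier_separable (p := p) c).of_dvd (minpoly.dvd K z (aeval_artinSchreier hc))
    rw [hgen] at h
    exact AlgEquiv.Algebra.isSeparable (IntermediateField.topEquiv (F := K) (E := L))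
  have hnorm : Normal K L := by
    refine normal_iff.2 fun z => ⟨Algebra.IsIntegral.isIntegral z, ?_⟩
    refine IntermediateField.splits_of_mem_adjoin K L (S := S) ?_ (hmem z)
    intro u hu
    refine ⟨hint u hu, ?_⟩
    obtain ⟨c, hc⟩ := hS u hu
    have h1 : ((X ^ p - X - C c : K[X]).map (algebraMap K L)).Splits := by
      rw [map_artinSchreier_eq_prod hc]
      exact Splits.prod fun _ _ => Splits.X_sub_C _
    exact h1.of_dvd (Polynomial.map_ne_zero (artinSchreier_ne_zero (p := p) c))
      (Polynomial.map_dvd _ (minpoly.dvd K u (aeval_artinSchreier hc)))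
  exact ⟨hfd, ⟨⟩⟩

/-- Galois conjugates of a root of an Artin-Schreier equation differ by elements of `𝔽_p`. -/
lemma exists_zmod_sub {z : L} {c : K} (hz : z ^ p - z = algebraMap K L c) (τ : L ≃ₐ[K] L) :
    ∃ a : ZMod p, algebraMap (ZMod p) L a = τ z - z := by
  have := charP_of_algebra_zmod p L
  apply exists_zmod_of_pow_eq
  have h : τ z ^ p - τ z = z ^ p - z := by
    rw [← map_pow, ← map_sub, hz, AlgEquiv.commutes]
  rw [sub_pow_char]
  linear_combination h

lemma algEquiv_zmod (τ : L ≃ₐ[K] L) (a : ZMod p) :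
    τ (algebraMap (ZMod p) L a) = algebraMap (ZMod p) L a := by
  rw [← ZMod.natCast_zmod_val a, map_natCast, map_natCast]

/-- The homomorphism `τ ↦ (τ - 1) z` from the Galois group to `𝔽_p`, for a root `z` of an
Artin-Schreier equation. -/
def coordHom {z : L} {c : K} (hz : z ^ p - z = algebraMap K L c) :
    (L ≃ₐ[K] L) →* Multiplicative (ZMod p) :=
  MonoidHom.mk' (fun τ => Multiplicative.ofAdd (exists_zmod_sub hz τ).choose) (by
    intro τ ρ
    rw [← ofAdd_add]
    congr 1
    apply (algebraMap (ZMod p) L).injective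
    rw [map_add, (exists_zmod_sub hz (τ * ρ)).choose_spec, (exists_zmod_sub hz τ).choose_spec,
      (exists_zmod_sub hz ρ).choose_spec, AlgEquiv.mul_apply]
    have h : ρ z = z + algebraMap (ZMod p) L (exists_zmod_sub hz ρ).choose := by
      rw [(exists_zmod_sub hz ρ).choose_spec]
      ring
    rw [h, map_add, algEquiv_zmod]
    ring)

lemma algebraMap_coordHom {z : L} {c : K} (hz : z ^ p - z = algebraMap K L c) (τ : L ≃ₐ[K] L) :
    algebraMap (ZMod p) L (coordHom hz τ).toAdd = τ z - z :=
  (exists_zmod_sub hz τ).choose_spec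

lemma coordHom_eq_one {z : L} {c : K} (hz : z ^ p - z = algebraMap K L c) {τ : L ≃ₐ[K] L} :
    coordHom hz τ = 1 ↔ τ z = z := by
  rw [← sub_eq_zero (a := τ z), ← algebraMap_coordHom hz, map_eq_zero]
  exact Iff.rfl

lemma algEquiv_ext_of_adjoin {S : Set L} (hgen : IntermediateField.adjoin K S = ⊤)
    {τ ρ : L ≃ₐ[K] L} (h : ∀ z ∈ S, τ z = ρ z) : τ = ρ := by
  ext z
  have hz : z ∈ IntermediateField.adjoin K S := hgen ▸ trivial
  induction hz using IntermediateField.adjoin_induction with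
  | mem z hz => exact h z hz
  | algebraMap a => rw [AlgEquiv.commutes, AlgEquiv.commutes]
  | add u v _ _ hu hv => rw [map_add, map_add, hu, hv]
  | inv u _ hu => rw [map_inv₀, map_inv₀, hu]
  | mul u v _ _ hu hv => rw [map_mul, map_mul, hu, hv]

end ArtinSchreier

section Powers

variable {M : Type*} [Field M] [Algebra (LaurentSeries F) M] {w : AddValuation M (WithTop ℤ)}
  {N : ℕ} {X : M} {c : ℤ}

lemma addVal_mul_pow (hw : ∀ a : LaurentSeries F, w (algebraMap _ M a) = N • vK F a)
    (hX : w X = ((-c : ℤ) : WithTop ℤ)) {a : LaurentSeries F} (ha : a ≠ 0) (k : ℕ) :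
    w (algebraMap _ M a * X ^ k) = ((N * a.order - k * c : ℤ) : WithTop ℤ) := by
  rw [w.map_mul, w.map_pow, hX, hw, HahnSeries.addVal_apply_of_ne ha, nsmul_coe, nsmul_coe,
    ← WithTop.coe_add]
  congr 1
  ring

/-- In a `K`-combination of the powers `X ^ k`, `k < N`, of an element whose value is prime to the
ramification index `N`, exactly one term has the smallest value. -/
lemma exists_dominant_term (hw : ∀ a : LaurentSeries F, w (algebraMap _ M a) = N • vK F a)
    (hX : w X = ((-c : ℤ) : WithTop ℤ)) (hc : IsCoprime c N) {a : ℕ → LaurentSeries F}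
    (ha : ∃ k < N, a k ≠ 0) :
    ∃ k₀ < N, a k₀ ≠ 0 ∧ ∀ k ∈ range N, k ≠ k₀ →
      w (algebraMap _ M (a k₀) * X ^ k₀) < w (algebraMap _ M (a k) * X ^ k) := by
  classical
  obtain ⟨k₀, hk₀, hmin⟩ := exists_strict_min hc (T := (range N).filter fun k => a k ≠ 0)
    (by obtain ⟨k, hk, hk'⟩ := ha; exact ⟨k, mem_filter.2 ⟨mem_range.2 hk, hk'⟩⟩)
    (fun k hk => mem_range.1 (mem_filter.1 hk).1) (fun k => (a k).order)
  rw [mem_filter, mem_range] at hk₀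
  refine ⟨k₀, hk₀.1, hk₀.2, fun k hk hne => ?_⟩
  rw [addVal_mul_pow hw hX hk₀.2]
  by_cases hk' : a k = 0
  · rw [hk', map_zero, zero_mul, w.map_zero]
    exact WithTop.coe_lt_top _
  · rw [addVal_mul_pow hw hX hk']
    exact_mod_cast hmin k (mem_filter.2 ⟨hk, hk'⟩) hne

lemma addVal_sum_eq {s : Finset ℕ} {f : ℕ → M} {k₀ : ℕ} (hk₀ : k₀ ∈ s) (h0 : w (f k₀) ≠ ⊤)
    (h : ∀ k ∈ s, k ≠ k₀ → w (f k₀) < w (f k)) : w (∑ k ∈ s, f k) = w (f k₀) := by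
  classical
  rw [← add_sum_erase _ _ hk₀]
  apply AddValuation.map_add_eq_of_lt_left
  apply AddValuation.map_lt_sum _ h0
  intro k hk
  exact h k (mem_of_mem_erase hk) (ne_of_mem_erase hk)

/-- The powers `X ^ k`, `k < N`, are independent over `K`, as their values are distinct modulo
`N`. -/
lemma linearIndependent_pow (hw : ∀ a : LaurentSeries F, w (algebraMap _ M a) = N • vK F a)
    (hX : w X = ((-c : ℤ) : WithTop ℤ)) (hc : IsCoprime c N) :
    LinearIndependent (LaurentSeries F) (fun k : Fin N => X ^ (k : ℕ)) := by
  rw [Fintype.linearIndependent_iff]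
  intro g hg
  by_contra! hne
  obtain ⟨i, hi⟩ := hne
  let a : ℕ → LaurentSeries F := fun k => if h : k < N then g ⟨k, h⟩ else 0
  have hag : ∀ k : Fin N, a k = g k := fun k => by simp [a]
  obtain ⟨k₀, hk₀, hk₀', hmin⟩ := exists_dominant_term (a := a) hw hX hc
    ⟨i, i.2, by rwa [hag]⟩
  have h1 := addVal_sum_eq (f := fun k => algebraMap _ M (a k) * X ^ k) (mem_range.2 hk₀)
    (by rw [addVal_mul_pow hw hX hk₀']; exact WithTop.coe_ne_top) hmin
  have h2 : ∑ k ∈ range N, algebraMap _ M (a k) * X ^ k = 0 := by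
    rw [sum_range, ← hg]
    exact sum_congr rfl fun k _ => by rw [hag, Algebra.smul_def]
  rw [h2, w.map_zero, addVal_mul_pow hw hX hk₀'] at h1
  exact WithTop.coe_ne_top h1.symm

lemma exists_sum_pow_of_finrank [FiniteDimensional (LaurentSeries F) M]
    (hw : ∀ a : LaurentSeries F, w (algebraMap _ M a) = N • vK F a)
    (hX : w X = ((-c : ℤ) : WithTop ℤ)) (hc : IsCoprime c N)
    (hN : Module.finrank (LaurentSeries F) M = N) (hN0 : 0 < N) (z : M) :
    ∃ a : ℕ → LaurentSeries F, z = ∑ k ∈ range N, algebraMap _ M (a k) * X ^ k := by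
  have := Fin.pos_iff_nonempty.1 hN0
  have hspan := (linearIndependent_pow hw hX hc).span_eq_top_of_card_eq_finrank
    (by rw [Fintype.card_fin, hN])
  have hz : z ∈ Submodule.span (LaurentSeries F) (Set.range fun k : Fin N => X ^ (k : ℕ)) :=
    hspan ▸ trivial
  obtain ⟨g, rfl⟩ := (Submodule.mem_span_range_iff_exists_fun _).1 hz
  refine ⟨fun k => if h : k < N then g ⟨k, h⟩ else 0, ?_⟩
  rw [sum_range]
  exact sum_congr rfl fun k _ => by simp [Algebra.smul_def]

variable [Algebra (ZMod p) M]

/-- If `v (Y - X) = v (X) + s` with `s > 0`, then `v (Y ^ k - X ^ k) ≥ v (X ^ k) + s`, with equality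
if `k` is prime to `p`: write `Y = X (1 + δ)` and sum the geometric progression. -/
lemma exists_pow_sub_pow (hXc : w X = ((-c : ℤ) : WithTop ℤ)) {Y : M} {s : ℤ} (hs : 0 < s)
    (hY : w (Y - X) = ((s - c : ℤ) : WithTop ℤ)) (k : ℕ) :
    ∃ u : M, Y ^ k - X ^ k = X ^ k * u ∧ (s : WithTop ℤ) ≤ w u ∧ (¬ p ∣ k → w u = s) := by
  have := charP_of_algebra_zmod p M
  have hX0 : X ≠ 0 := by
    rintro rfl
    rw [w.map_zero] at hXc
    exact WithTop.coe_ne_top hXc.symm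
  obtain ⟨δ, hδ⟩ : ∃ δ, Y = X * (1 + δ) := ⟨Y / X - 1, by field_simp; ring⟩
  have hδs : w δ = s := by
    have h1 : Y - X = X * δ := by rw [hδ]; ring
    have hδ0 : δ ≠ 0 := by
      rintro rfl
      rw [h1, mul_zero, w.map_zero] at hY
      exact WithTop.coe_ne_top hY.symm
    obtain ⟨r, hr⟩ := exists_int_of_ne_zero w hδ0
    rw [h1, w.map_mul, hXc, hr, ← WithTop.coe_add] at hY
    have h2 : -c + r = s - c := by exact_mod_cast hY
    rw [hr]
    congr 1
    omega
  have hs0 : (0 : WithTop ℤ) ≤ s := by exact_mod_cast hs.le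
  have hone : 0 ≤ w (1 + δ) := w.map_le_add (by simp) (by rw [hδs]; exact hs0)
  have hgeom : (∑ l ∈ range k, (1 + δ) ^ l) * δ = (1 + δ) ^ k - 1 := by
    have h := geom_sum_mul (1 + δ) k
    rwa [add_sub_cancel_left] at h
  have hgnn : ∀ j, 0 ≤ w (∑ l ∈ range j, (1 + δ) ^ l) := fun j => by
    apply w.map_le_sum
    intro l _
    rw [w.map_pow]
    exact nsmul_nonneg hone l
  refine ⟨(∑ l ∈ range k, (1 + δ) ^ l) * δ, ?_, ?_, fun hk => ?_⟩
  · rw [hgeom, hδ, mul_pow]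
    ring
  · rw [w.map_mul, hδs]
    exact le_add_of_nonneg_left (hgnn k)
  · have hk0 : ((k : ZMod p)) ≠ 0 := by
      rwa [Ne, ZMod.natCast_eq_zero_iff]
    have hkM : w (k : M) = 0 := by
      have := addVal_algebraMap_zmod w hk0
      rwa [map_natCast] at this
    have hsum : ∑ l ∈ range k, (1 + δ) ^ l = (k : M) + ∑ l ∈ range k, ((1 + δ) ^ l - 1) := by
      rw [sum_sub_distrib]
      simp
    have hpos : w (k : M) < w (∑ l ∈ range k, ((1 + δ) ^ l - 1)) := by
      rw [hkM]
      apply AddValuation.map_lt_sum _ (by exact WithTop.coe_ne_top (a := (0 : ℤ)))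
      intro l _
      have h := geom_sum_mul (1 + δ) l
      rw [add_sub_cancel_left] at h
      rw [← h, w.map_mul, hδs]
      refine lt_of_lt_of_le ?_ (le_add_of_nonneg_left (hgnn l))
      exact_mod_cast hs
    rw [w.map_mul, hsum, w.map_add_eq_of_lt_left hpos, hkM, hδs, zero_add]

/-- If the ramification index `N` is a multiple of `p` and `v (σ X - X) = v (X) + s` for an element
`X` whose value is prime to `N`, then `v (σ z - z) = v (z) + s` for every `z` of value `1`. -/
lemma addVal_sub_of_value_one [FiniteDimensional (LaurentSeries F) M]
    (hw : ∀ a : LaurentSeries F, w (algebraMap _ M a) = N • vK F a)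
    (hX : w X = ((-c : ℤ) : WithTop ℤ)) (hc : IsCoprime c N)
    (hN : Module.finrank (LaurentSeries F) M = N) (hN0 : 0 < N) (hpN : p ∣ N)
    (σ : M ≃ₐ[LaurentSeries F] M) {s : ℤ} (hs : 0 < s)
    (hσ : w (σ X - X) = ((s - c : ℤ) : WithTop ℤ)) {z : M} (hz : w z = ((1 : ℤ) : WithTop ℤ)) :
    w (σ z - z) = ((s + 1 : ℤ) : WithTop ℤ) := by
  obtain ⟨a, ha⟩ := exists_sum_pow_of_finrank hw hX hc hN hN0 z
  have hne : ∃ k < N, a k ≠ 0 := by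
    by_contra! h
    have : z = 0 := by
      rw [ha]
      apply sum_eq_zero
      intro k hk
      rw [h k (mem_range.1 hk), map_zero, zero_mul]
    rw [this, w.map_zero] at hz
    exact WithTop.coe_ne_top hz.symm
  obtain ⟨k₀, hk₀, hak₀, hmin⟩ := exists_dominant_term hw hX hc hne
  have hval := addVal_mul_pow hw hX hak₀ k₀
  have hz1 : w (algebraMap _ M (a k₀) * X ^ k₀) = ((1 : ℤ) : WithTop ℤ) := by
    rw [← hz, ha]
    exact (addVal_sum_eq (f := fun k => algebraMap _ M (a k) * X ^ k) (mem_range.2 hk₀)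
      (by rw [hval]; exact WithTop.coe_ne_top) hmin).symm
  -- the value `1` is not divisible by `p`, hence neither is `k₀`
  have hpk : ¬ p ∣ k₀ := by
    intro hdvd
    rw [hval] at hz1
    have h1 : (N : ℤ) * (a k₀).order - k₀ * c = 1 := by exact_mod_cast hz1
    have h2 : (p : ℤ) ∣ 1 := by
      rw [← h1]
      exact dvd_sub ((Int.natCast_dvd_natCast.2 hpN).mul_right _)
        ((Int.natCast_dvd_natCast.2 hdvd).mul_right _)
    exact (Fact.out : p.Prime).one_lt.ne' (by exact_mod_cast Int.eq_one_of_dvd_one (by positivity) h2)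
  choose u hu hsu hus using exists_pow_sub_pow (p := p) hX hs hσ
  have hdiff : σ z - z = ∑ k ∈ range N, algebraMap _ M (a k) * X ^ k * u k := by
    rw [ha, map_sum, ← sum_sub_distrib]
    apply sum_congr rfl
    intro k _
    rw [map_mul, AlgEquiv.commutes, map_pow, mul_assoc, ← hu]
    ring
  have hmain : w (algebraMap _ M (a k₀) * X ^ k₀ * u k₀) = ((s + 1 : ℤ) : WithTop ℤ) := by
    rw [w.map_mul, hz1, hus k₀ hpk, ← WithTop.coe_add, add_comm]
  rw [hdiff, addVal_sum_eq (f := fun k => algebraMap _ M (a k) * X ^ k * u k) (mem_range.2 hk₀)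
    (by rw [hmain]; exact WithTop.coe_ne_top), hmain]
  intro k hk hne
  simp only [w.map_mul _ (u _)]
  rw [hus k₀ hpk, hz1]
  have h1 := hmin k hk hne
  rw [hz1] at h1
  calc ((1 : ℤ) : WithTop ℤ) + s < w (algebraMap _ M (a k) * X ^ k) + s :=
        WithTop.add_lt_add_right WithTop.coe_ne_top h1
    _ ≤ _ := by gcongr; exact hsu k

end Powers

end

/-! ### The Galois group and its ramification -/

section

open Finset

variable {p n : ℕ} [Fact p.Prime] {F : Type*} [Field F] [Algebra (ZMod p) F]
  {L : Type*} [Field L] [Algebra (LaurentSeries F) L]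
  {b : ℕ} {β : LaurentSeries F} {Ω ε : ℕ → LaurentSeries F} {x : ℕ → L}

lemma vE_eq {M : Type*} [Field M] [Algebra (LaurentSeries F) M]
    {w : AddValuation M (WithTop ℤ)} (hw : IsNormalizedExtension F M w)
    (hu : ∀ w', IsNormalizedExtension F M w' → w' = w) : vE F M = w :=
  hu _ (Classical.epsilon_spec ⟨w, hw⟩)

lemma eq_of_nsmul_eq {e : ℕ} (he : 0 < e) {g : WithTop ℤ} {r : ℤ}
    (h : e • g = ((e * r : ℤ) : WithTop ℤ)) : g = r := by
  induction g using WithTop.recTopCoe with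
  | top =>
    obtain ⟨k, rfl⟩ := Nat.exists_eq_succ_of_ne_zero he.ne'
    rw [succ_nsmul, add_top] at h
    exact absurd h.symm WithTop.coe_ne_top
  | coe g =>
    rw [nsmul_coe] at h
    have h1 : (e : ℤ) * g = e * r := by exact_mod_cast h
    rw [mul_left_cancel₀ (by exact_mod_cast he.ne') h1]

namespace IsNearOneDim

/-- The normalized valuation of `L`. -/
theorem vE_top (hL : IsNearOneDim p n b β Ω ε x) :
    IsNormalizedExtension F L (vE F L) ∧
      (∀ w', IsNormalizedExtension F L w' → w' = vE F L) ∧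
      (∀ a : LaurentSeries F, vE F L (algebraMap _ L a) = p ^ (n + 1) • vK F a) ∧
      vE F L (XRec p n Ω x n n) = ((-(bLow p n b Ω n) : ℤ) : WithTop ℤ) := by
  obtain ⟨w, hw, hu, hK, hX⟩ := hL.exists_normalized le_rfl hL.equation hL.generate
  rw [vE_eq hw hu]
  exact ⟨hw, hu, hK, hX⟩

/-- The normalized valuation of `K_j`, and its value at `X_j`. -/
theorem vE_Kfield (hL : IsNearOneDim p n b β Ω ε x) {j : ℕ} (hj : j ≤ n) :
    (∃! w, IsNormalizedExtension F (Kfield F x j) w) ∧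
    ∃ h : XRec p n Ω x j j ∈ Kfield F x j,
      vE F (Kfield F x j) ⟨XRec p n Ω x j j, h⟩ = ((-(bLow p n b Ω j) : ℤ) : WithTop ℤ) := by
  have hmem : ∀ l ≤ j, x l ∈ Kfield F x j := fun l hl =>
    IntermediateField.subset_adjoin _ _ ⟨l, hl, rfl⟩
  let y : ℕ → Kfield F x j := fun l => if hl : l ≤ j then ⟨x l, hmem l hl⟩ else 0
  have hyx : ∀ l ≤ j, (y l : L) = x l := fun l hl => by simp [y, hl]
  have hy : ∀ i ≤ j, y i ^ p - y i =
      algebraMap (LaurentSeries F) (Kfield F x j) (Ω i ^ p ^ n * β + ε i) := by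
    intro i hi
    apply Subtype.ext
    change (y i : L) ^ p - (y i : L) = _
    rw [hyx i hi]
    exact hL.equation i (hi.trans hj)
  have hgen : IntermediateField.adjoin (LaurentSeries F) (y '' Set.Iic j) = ⊤ := by
    apply IntermediateField.map_injective (Kfield F x j).val
    rw [IntermediateField.adjoin_map, ← AlgHom.fieldRange_eq_map, IntermediateField.fieldRange_val]
    congr 1
    rw [← Set.image_comp]
    exact Set.image_congr fun l hl => hyx l hl
  obtain ⟨w, hw, hu, -, hX⟩ := hL.exists_normalized hj hy hgen
  refine ⟨⟨w, hw, hu⟩, XRec_mem j j le_rfl hmem, ?_⟩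
  have hXx : (⟨XRec p n Ω x j j, XRec_mem j j le_rfl hmem⟩ : Kfield F x j) = XRec p n Ω y j j :=
    Subtype.ext (map_XRec (Kfield F x j).val Ω j j le_rfl hyx).symm
  rw [hXx, vE_eq hw hu, hX]

lemma isGalois (hL : IsNearOneDim p n b β Ω ε x) [Algebra (ZMod p) L] :
    FiniteDimensional (LaurentSeries F) L ∧ IsGalois (LaurentSeries F) L := by
  have := charP_laurentSeries p F
  refine isGalois_of_artinSchreier (p := p) ((Set.finite_Iic n).image x) ?_ hL.generate
  rintro _ ⟨i, hi, rfl⟩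
  exact ⟨_, hL.equation i hi⟩

lemma algEquiv_ext (hL : IsNearOneDim p n b β Ω ε x) {τ ρ : L ≃ₐ[LaurentSeries F] L}
    (h : ∀ i ≤ n, τ (x i) = ρ (x i)) : τ = ρ := by
  refine algEquiv_ext_of_adjoin hL.generate ?_
  rintro _ ⟨i, hi, rfl⟩
  exact h i hi

/-- The `n + 1` coordinates `(τ - 1) x_i ∈ 𝔽_p` of an element of the Galois group are arbitrary:
the powers of `X_n` show that the degree is at least `p ^ (n + 1)`. -/
theorem coord_bijective (hL : IsNearOneDim p n b β Ω ε x) [Algebra (ZMod p) L] :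
    Module.finrank (LaurentSeries F) L = p ^ (n + 1) ∧
    Function.Bijective (fun (τ : L ≃ₐ[LaurentSeries F] L) (i : Fin (n + 1)) =>
      coordHom (hL.equation i (Nat.lt_succ_iff.1 i.2)) τ) := by
  obtain ⟨hfd, hgal⟩ := hL.isGalois
  obtain ⟨-, -, hK, hX⟩ := hL.vE_top
  have hinj : Function.Injective (fun (τ : L ≃ₐ[LaurentSeries F] L) (i : Fin (n + 1)) =>
      coordHom (hL.equation i (Nat.lt_succ_iff.1 i.2)) τ) := by
    intro τ ρ h
    apply hL.algEquiv_ext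
    intro i hi
    have h1 := congrFun h ⟨i, Nat.lt_succ_iff.2 hi⟩
    have h2 := algebraMap_coordHom (hL.equation i hi) τ
    have h3 := algebraMap_coordHom (hL.equation i hi) ρ
    rw [show coordHom (hL.equation i hi) τ = coordHom (hL.equation i hi) ρ from h1, h3] at h2
    exact (sub_left_inj.1 h2).symm
  have hcard : Nat.card (Fin (n + 1) → Multiplicative (ZMod p)) = p ^ (n + 1) := by
    rw [Nat.card_fun, Nat.card_congr Multiplicative.toAdd, Nat.card_zmod, Nat.card_fin]
  have hle : p ^ (n + 1) ≤ Module.finrank (LaurentSeries F) L := by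
    have h := (linearIndependent_pow hK hX (hL.bLow_isCoprime_pow n (n + 1))).fintype_card_le_finrank
    rwa [Fintype.card_fin] at h
  have hG := IsGalois.card_aut_eq_finrank (LaurentSeries F) L
  have hge := Nat.card_le_card_of_injective _ hinj
  rw [hcard, hG] at hge
  have hfr := le_antisymm hge hle
  refine ⟨hfr, (Nat.bijective_iff_injective_and_card _).2 ⟨hinj, ?_⟩⟩
  rw [hcard, hG, hfr]

/-- Elements of the Galois group that are dual to the `x_j`. -/
lemma exists_dual (hL : IsNearOneDim p n b β Ω ε x) [Algebra (ZMod p) L] :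
    ∃ σ : ℕ → (L ≃ₐ[LaurentSeries F] L),
      ∀ i ≤ n, ∀ j ≤ n, σ i (x j) - x j = if i = j then 1 else 0 := by
  choose σ hσ using fun i : ℕ => hL.coord_bijective.2.2 fun j : Fin (n + 1) =>
    Multiplicative.ofAdd (if i = j then (1 : ZMod p) else 0)
  refine ⟨σ, fun i _ j hj => ?_⟩
  have h1 := congrFun (hσ i) ⟨j, Nat.lt_succ_iff.2 hj⟩
  rw [← algebraMap_coordHom (hL.equation j hj) (σ i)]
  rw [show coordHom (hL.equation j hj) (σ i) =
    Multiplicative.ofAdd (if i = j then (1 : ZMod p) else 0) from h1, toAdd_ofAdd]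
  split_ifs <;> simp

lemma gal_pow_eq_one (hL : IsNearOneDim p n b β Ω ε x) [Algebra (ZMod p) L]
    (τ : L ≃ₐ[LaurentSeries F] L) : τ ^ p = 1 := by
  apply hL.algEquiv_ext
  intro i hi
  rw [AlgEquiv.one_apply, ← coordHom_eq_one (hL.equation i hi), map_pow, ← toAdd_eq_zero, toAdd_pow,
    nsmul_eq_mul, CharP.cast_eq_zero, zero_mul]

lemma gal_mul_comm (hL : IsNearOneDim p n b β Ω ε x) [Algebra (ZMod p) L]
    (τ ρ : L ≃ₐ[LaurentSeries F] L) : τ * ρ = ρ * τ := by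
  apply hL.algEquiv_ext
  intro i hi
  have h2 := algebraMap_coordHom (hL.equation i hi) (τ * ρ)
  have h3 := algebraMap_coordHom (hL.equation i hi) (ρ * τ)
  rw [map_mul, mul_comm, ← map_mul, h3] at h2
  exact (sub_left_inj.1 h2).symm

/-- The break of `τ` is `b_(i)`, where `i` is the first index with `τ x_i ≠ x_i`. -/
theorem hasBreak (hL : IsNearOneDim p n b β Ω ε x) [Algebra (ZMod p) L]
    {τ : L ≃ₐ[LaurentSeries F] L} {i : ℕ} (hi : i ≤ n) (hfix : ∀ l < i, τ (x l) = x l)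
    (hmove : τ (x i) ≠ x i) : HasBreak τ (bLow p n b Ω i) := by
  have := charP_of_algebra_zmod p L
  obtain ⟨hfd, -⟩ := hL.isGalois
  obtain ⟨-, -, hK, hX⟩ := hL.vE_top
  have hq : 0 < p ^ (n + 1) := pow_pos (Fact.out : p.Prime).pos _
  have hA := extendsVK_of_restrict hq hK
  set d : ℕ → L := fun j => τ (XRec p n Ω x j j) - XRec p n Ω x j j with hd
  -- `τ` fixes `x_i - X_i`
  have hdi : d i = τ (x i) - x i := by
    have h1 := sub_XRec_mem (p := p) (n := n) (Ω := Ω)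
      (S := IntermediateField.fixedField (Subgroup.closure {τ})) i i le_rfl (fun l hl => by
        rw [IntermediateField.mem_fixedField_iff]
        intro g hg
        induction hg using Subgroup.closure_induction with
        | mem g hg => rw [Set.mem_singleton_iff.1 hg, hfix l hl]
        | one => rfl
        | mul g h _ _ hg hh => rw [AlgEquiv.mul_apply, hh, hg]
        | inv g _ hg => nth_rewrite 1 [← hg]; exact g.symm_apply_apply _)
    have h2 := (IntermediateField.mem_fixedField_iff _ _).1 h1 τ
      (Subgroup.subset_closure (Set.mem_singleton τ))
    rw [map_sub] at h2
    simp only [hd]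
    linear_combination -h2
  have hunit : (ringOfAddVal (vE F L)).valuation (d i) = 1 := by
    obtain ⟨a, ha⟩ := exists_zmod_sub (hL.equation i hi) τ
    have ha0 : a ≠ 0 := by
      rintro rfl
      rw [map_zero] at ha
      exact hmove (sub_eq_zero.1 ha.symm)
    have hp1 : p - 1 ≠ 0 := by
      have := (Fact.out : p.Prime).one_lt
      omega
    rw [hdi, ← ha, ← pow_eq_one_iff_of_nonneg zero_le hp1, ← map_pow, ← map_pow,
      ZMod.pow_card_sub_one_eq_one ha0, map_one, map_one]
  have hrec : ∀ j, i ≤ j → j + 1 ≤ n → d (j + 1) ^ p - d (j + 1) =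
      -(algebraMap _ L (mainCoeff p n Ω j (j + 1))) * d j := by
    intro j _ hj
    have h1 := hL.wp_XRec le_rfl hL.equation j (j + 1) le_rfl hj
    have h2 := congrArg τ h1
    simp only [map_sub, map_add, map_mul, map_neg, map_pow, AlgEquiv.commutes] at h2
    simp only [hd]
    rw [sub_pow_char]
    linear_combination h2 - h1
  have hdn := hL.val_of_homogeneous hA hunit hrec n hi le_rfl
  have hdn' := eq_of_nsmul_eq hq (nsmul_addVal_eq hq hK hdn)
  intro π hπ
  exact addVal_sub_of_value_one hK hX (hL.bLow_isCoprime_pow n (n + 1)) hL.coord_bijective.1 hq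
    (dvd_pow_self p (Nat.succ_ne_zero n)) τ (hL.bLow_pos hi) hdn' hπ

/-- An element that fixes `x_l` for all `l < i`, but not all `x_l` with `l < k`, has a first moved
generator with index between `i` and `k`. -/
lemma exists_first_moved {τ : L ≃ₐ[LaurentSeries F] L} {k : ℕ} (h : ¬ ∀ l < k, τ (x l) = x l) :
    ∃ i < k, (∀ l < i, τ (x l) = x l) ∧ τ (x i) ≠ x i := by
  classical
  have hex : ∃ i, i < k ∧ τ (x i) ≠ x i := by
    by_contra! h'
    exact h h'
  refine ⟨Nat.find hex, (Nat.find_spec hex).1, fun l hl => ?_, (Nat.find_spec hex).2⟩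
  by_contra hne
  exact Nat.find_min hex hl ⟨hl.trans (Nat.find_spec hex).1, hne⟩

/-- `G_r` consists of the elements whose first moved generator `x_i` has `b_(i) ≥ r`. -/
lemma mem_ramificationGroup_iff (hL : IsNearOneDim p n b β Ω ε x) [Algebra (ZMod p) L]
    {τ : L ≃ₐ[LaurentSeries F] L} {r : ℤ} :
    τ ∈ ramificationGroup F L r ↔
      ∀ i ≤ n, (∀ l < i, τ (x l) = x l) → τ (x i) ≠ x i → r ≤ bLow p n b Ω i := by
  constructor
  · intro h i hi hfix hmove
    obtain ⟨π, hπ⟩ := hL.vE_top.1.1 ((1 : ℤ) : WithTop ℤ)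
    have h1 := h π hπ
    rw [hL.hasBreak hi hfix hmove π hπ] at h1
    have h2 : r + 1 ≤ bLow p n b Ω i + 1 := by exact_mod_cast h1
    linarith
  · intro h π hπ
    by_cases hτ : ∀ l < n + 1, τ (x l) = x l
    · have h1 : τ = 1 := hL.algEquiv_ext fun l hl => hτ l (Nat.lt_succ_iff.2 hl)
      rw [h1, AlgEquiv.one_apply, sub_self, AddValuation.map_zero]
      exact le_top
    · obtain ⟨i, hi, hfix, hmove⟩ := exists_first_moved hτ
      rw [hL.hasBreak (Nat.lt_succ_iff.1 hi) hfix hmove π hπ]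
      have h1 := h i (Nat.lt_succ_iff.1 hi) hfix hmove
      exact_mod_cast (by linarith : r + 1 ≤ bLow p n b Ω i + 1)

section Dual

variable {σ : ℕ → (L ≃ₐ[LaurentSeries F] L)}

lemma dual_self (hσ : ∀ i ≤ n, ∀ j ≤ n, σ i (x j) - x j = if i = j then 1 else 0) {i : ℕ}
    (hi : i ≤ n) : σ i (x i) = x i + 1 := by
  have := hσ i hi i hi
  rw [if_pos rfl] at this
  linear_combination this

lemma dual_of_ne (hσ : ∀ i ≤ n, ∀ j ≤ n, σ i (x j) - x j = if i = j then 1 else 0) {i j : ℕ}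
    (hi : i ≤ n) (hj : j ≤ n) (hij : i ≠ j) : σ i (x j) = x j := by
  have := hσ i hi j hj
  rw [if_neg hij] at this
  exact sub_eq_zero.1 this

/-- `G_(i)` consists of the elements that fix `x_0, …, x_{i-1}`. -/
lemma mem_Gsub_iff (hL : IsNearOneDim p n b β Ω ε x) [Algebra (ZMod p) L]
    (hσ : ∀ i ≤ n, ∀ j ≤ n, σ i (x j) - x j = if i = j then 1 else 0) {i : ℕ} (hi : i ≤ n + 1)
    {τ : L ≃ₐ[LaurentSeries F] L} : τ ∈ Gsub n σ i ↔ ∀ l < i, τ (x l) = x l := by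
  constructor
  · intro h l hl
    induction h using Subgroup.closure_induction with
    | mem g hg =>
      obtain ⟨k, hk, rfl⟩ := hg
      exact dual_of_ne hσ hk.2 (by omega) (by have := hk.1; omega)
    | one => rfl
    | mul g h _ _ hg hh => rw [AlgEquiv.mul_apply, hh, hg]
    | inv g _ hg => nth_rewrite 1 [← hg]; exact g.symm_apply_apply _
  · obtain ⟨k, hk⟩ : ∃ k, i + k = n + 1 := ⟨n + 1 - i, by omega⟩
    induction k generalizing i τ with
    | zero =>
      intro h
      have h1 : τ = 1 := hL.algEquiv_ext fun l hl => h l (by omega)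
      rw [h1]
      exact one_mem _
    | succ k ih =>
      intro h
      -- a power of `σ_i` acts on `x_i` in the same way as `τ`
      obtain ⟨a, ha⟩ := exists_zmod_sub (hL.equation i (by omega)) τ
      have hpow : ∀ m : ℕ, (σ i ^ m) (x i) = x i + m := by
        intro m
        induction m with
        | zero => simp
        | succ m ihm =>
          rw [pow_succ', AlgEquiv.mul_apply, ihm, map_add, dual_self hσ (by omega), map_natCast]
          push_cast
          ring
      have hpow' : ∀ (m l : ℕ), l < i → (σ i ^ m) (x l) = x l := by
        intro m l hl
        induction m with
        | zero => simp
        | succ m ihm =>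
          rw [pow_succ', AlgEquiv.mul_apply, ihm, dual_of_ne hσ (by omega) (by omega) (by omega)]
      have hτi : τ (x i) = (σ i ^ a.val) (x i) := by
        rw [hpow, ← map_natCast (algebraMap (ZMod p) L), ZMod.natCast_zmod_val, ha]
        ring
      have hρ : (σ i ^ a.val)⁻¹ * τ ∈ Gsub n σ (i + 1) := by
        apply ih (by omega) (by omega)
        intro l hl
        rw [AlgEquiv.mul_apply]
        rcases Nat.lt_succ_iff_lt_or_eq.1 hl with hl | rfl
        · rw [h l hl]
          nth_rewrite 1 [← hpow' a.val l hl]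
          exact (σ i ^ a.val).symm_apply_apply _
        · rw [hτi]
          exact (σ l ^ a.val).symm_apply_apply _
      have hle : Gsub n σ (i + 1) ≤ Gsub n σ i :=
        Subgroup.closure_mono (Set.image_mono (Set.Icc_subset_Icc_left (Nat.le_succ i)))
      have hσi : σ i ^ a.val ∈ Gsub n σ i :=
        pow_mem (Subgroup.subset_closure (Set.mem_image_of_mem σ (Set.mem_Icc.2 ⟨le_rfl, by omega⟩))) _
      have h2 := mul_mem hσi (hle hρ)
      rwa [mul_inv_cancel_left] at h2

/-- The fixed field of `G_(i)` is `K(x_0, …, x_{i-1})`. -/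
lemma fixedBy_eq (hL : IsNearOneDim p n b β Ω ε x) [Algebra (ZMod p) L]
    (hσ : ∀ i ≤ n, ∀ j ≤ n, σ i (x j) - x j = if i = j then 1 else 0) {i : ℕ} (hi : i ≤ n + 1) :
    fixedBy n σ i = IntermediateField.adjoin (LaurentSeries F) (x '' Set.Iio i) := by
  obtain ⟨hfd, hgal⟩ := hL.isGalois
  have h : Gsub n σ i =
      (IntermediateField.adjoin (LaurentSeries F) (x '' Set.Iio i)).fixingSubgroup := by
    ext τ
    rw [hL.mem_Gsub_iff hσ hi, IntermediateField.mem_fixingSubgroup_iff]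
    constructor
    · intro hτ z hz
      induction hz using IntermediateField.adjoin_induction with
      | mem z hz =>
        obtain ⟨l, hl, rfl⟩ := hz
        exact hτ l hl
      | algebraMap a => rw [AlgEquiv.commutes]
      | add u v _ _ hu hv => rw [map_add, hu, hv]
      | inv u _ hu => rw [map_inv₀, hu]
      | mul u v _ _ hu hv => rw [map_mul, hu, hv]
    · exact fun hτ l hl => hτ _ (IntermediateField.subset_adjoin _ _ ⟨l, hl, rfl⟩)
  rw [fixedBy, h, IsGalois.fixedField_fixingSubgroup]

lemma fixedBy_succ_eq (hL : IsNearOneDim p n b β Ω ε x) [Algebra (ZMod p) L]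
    (hσ : ∀ i ≤ n, ∀ j ≤ n, σ i (x j) - x j = if i = j then 1 else 0) {j : ℕ} (hj : j ≤ n) :
    fixedBy n σ (j + 1) = Kfield F x j := by
  have : Set.Iio (j + 1) = Set.Iic j := by ext; simp
  rw [hL.fixedBy_eq hσ (by omega), this]

lemma relIndex_Gsub (hL : IsNearOneDim p n b β Ω ε x) [Algebra (ZMod p) L]
    (hσ : ∀ i ≤ n, ∀ j ≤ n, σ i (x j) - x j = if i = j then 1 else 0) {i : ℕ} (hi : i ≤ n) :
    (Gsub n σ (i + 1)).relIndex (Gsub n σ i) = p := by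
  set f := coordHom (hL.equation i hi) with hf
  have h1 : Gsub n σ (i + 1) = Gsub n σ i ⊓ f.ker := by
    ext τ
    rw [Subgroup.mem_inf, hL.mem_Gsub_iff hσ (by omega), hL.mem_Gsub_iff hσ (by omega),
      MonoidHom.mem_ker, coordHom_eq_one]
    constructor
    · exact fun h => ⟨fun l hl => h l (by omega), h i (by omega)⟩
    · rintro ⟨h, h'⟩ l hl
      rcases Nat.lt_succ_iff_lt_or_eq.1 hl with hl | rfl
      · exact h l hl
      · exact h'
  have h2 : (Gsub n σ i).map f = ⊤ := by
    rw [eq_top_iff]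
    intro a _
    have hσi : σ i ∈ Gsub n σ i := Subgroup.subset_closure ⟨i, ⟨le_rfl, hi⟩, rfl⟩
    have hfσ : f (σ i) = Multiplicative.ofAdd 1 := by
      apply Multiplicative.toAdd.injective
      apply (algebraMap (ZMod p) L).injective
      rw [algebraMap_coordHom, dual_self hσ hi, toAdd_ofAdd, map_one]
      ring
    refine ⟨σ i ^ a.toAdd.val, pow_mem hσi _, ?_⟩
    rw [map_pow, hfσ, ← ofAdd_nsmul, nsmul_one, ZMod.natCast_zmod_val, ofAdd_toAdd]
  rw [h1, Subgroup.inf_relIndex_left, Subgroup.relIndex_ker, h2]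
  rw [Nat.card_congr Subgroup.topEquiv.toEquiv, Nat.card_congr Multiplicative.toAdd, Nat.card_zmod]

lemma isOrganized (hL : IsNearOneDim p n b β Ω ε x) [Algebra (ZMod p) L]
    (hσ : ∀ i ≤ n, ∀ j ≤ n, σ i (x j) - x j = if i = j then 1 else 0) : IsOrganized p n σ where
  top := by
    rw [eq_top_iff]
    intro τ _
    rw [hL.mem_Gsub_iff hσ (Nat.zero_le _)]
    exact fun l hl => absurd hl (Nat.not_lt_zero l)
  step i hi := hL.relIndex_Gsub hσ hi
  ramification r := by
    classical
    have hex : ∃ i, i = n + 1 ∨ (i ≤ n ∧ r ≤ bLow p n b Ω i) := ⟨n + 1, Or.inl rfl⟩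
    have hle : Nat.find hex ≤ n + 1 := Nat.find_min' hex (Or.inl rfl)
    refine ⟨Nat.find hex, hle, ?_⟩
    ext τ
    rw [SetLike.mem_coe, hL.mem_Gsub_iff hσ hle, hL.mem_ramificationGroup_iff]
    constructor
    · intro h k hk hfix hmove
      have h1 : Nat.find hex ≤ k := by
        by_contra! h2
        exact hmove (h k h2)
      rcases Nat.find_spec hex with h2 | ⟨h2, h3⟩
      · omega
      · exact h3.trans (hL.bLow_mono h1 hk)
    · intro h
      by_contra h1
      obtain ⟨k, hk, hfix, hmove⟩ := exists_first_moved h1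
      exact Nat.find_min hex hk (Or.inr ⟨by omega, h k (by omega) hfix hmove⟩)

lemma hasBreak_dual (hL : IsNearOneDim p n b β Ω ε x) [Algebra (ZMod p) L]
    (hσ : ∀ i ≤ n, ∀ j ≤ n, σ i (x j) - x j = if i = j then 1 else 0) {i : ℕ} (hi : i ≤ n) :
    HasBreak (σ i) (bLow p n b Ω i) := by
  refine hL.hasBreak hi (fun l hl => dual_of_ne hσ hi (by omega) (by omega)) ?_
  rw [dual_self hσ hi]
  simp

theorem lowerBreaks_eq (hL : IsNearOneDim p n b β Ω ε x) [Algebra (ZMod p) L] :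
    lowerBreaks F L = bLow p n b Ω '' Set.Iic n := by
  obtain ⟨σ, hσ⟩ := hL.exists_dual
  ext r
  constructor
  · intro h
    by_contra hr
    apply h
    ext τ
    rw [hL.mem_ramificationGroup_iff, hL.mem_ramificationGroup_iff]
    constructor
    · intro h i hi hfix hmove
      linarith [h i hi hfix hmove]
    · intro h i hi hfix hmove
      have h1 : r ≠ bLow p n b Ω i := fun heq => hr ⟨i, hi, heq.symm⟩
      have h2 := h i hi hfix hmove
      omega
  · rintro ⟨i, hi, rfl⟩ heq
    have hfix : ∀ l < i, σ i (x l) = x l := fun l hl =>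
      dual_of_ne hσ hi (by have : i ≤ n := hi; omega) (by omega)
    have hmove : σ i (x i) ≠ x i := by
      rw [dual_self hσ hi]
      simp
    have h1 : σ i ∈ ramificationGroup F L (bLow p n b Ω i) := by
      rw [hL.mem_ramificationGroup_iff]
      intro k hk hfix' hmove'
      refine hL.bLow_mono ?_ hk
      by_contra! h2
      exact hmove' (hfix k h2)
    rw [← heq, hL.mem_ramificationGroup_iff] at h1
    have := h1 i hi hfix hmove
    omega

/-- If all `(τ - 1) x_l` lie in `K`, then so do the `(τ - 1) X_j^{(i)}`. -/
lemma XRec_sub_mem_range (τ : L ≃ₐ[LaurentSeries F] L)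
    (hτ : ∀ l ≤ n, τ (x l) - x l ∈ Set.range (algebraMap (LaurentSeries F) L)) (i : ℕ) :
    ∀ j, i ≤ j → j ≤ n → τ (XRec p n Ω x i j) - XRec p n Ω x i j ∈
      Set.range (algebraMap (LaurentSeries F) L) := by
  induction i with
  | zero => exact fun j _ hj => hτ j hj
  | succ i ih =>
    intro j hij hj
    obtain ⟨u, hu⟩ := ih j (by omega) hj
    obtain ⟨v, hv⟩ := ih i le_rfl (by omega)
    refine ⟨u - OmegaRec p Ω i j ^ p ^ (n - (i + 1)) * v, ?_⟩
    rw [map_sub, map_mul, hu, hv, XRec, map_sub, map_mul, AlgEquiv.commutes]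
    ring

lemma entriesInBase (hσ : ∀ i ≤ n, ∀ j ≤ n, σ i (x j) - x j = if i = j then 1 else 0) :
    EntriesInBase n σ (fun j => XRec p n Ω x j j) := by
  intro i hi j hj
  refine XRec_sub_mem_range (σ i) (fun l hl => ?_) j j le_rfl hj
  rw [hσ i hi l hl]
  split_ifs
  · exact ⟨1, map_one _⟩
  · exact ⟨0, map_zero _⟩

/-- `[x_j] = [X_j] [Ω^φ]`. -/
lemma sum_XRec_mul_OmegaPhi (j : Fin (n + 1)) :
    ∑ k : Fin (n + 1), XRec p n Ω x k k * algebraMap _ L (OmegaPhi p n Ω k j) = x j := by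
  have h1 : ∀ i : ℕ, XRec p n Ω x i j +
      ∑ k ∈ range i, XRec p n Ω x k k *
        algebraMap _ L (OmegaRec p Ω k j ^ p ^ (n - 1 - k)) = x j := by
    intro i
    induction i with
    | zero => simp [XRec]
    | succ i ih =>
      rw [sum_range_succ, XRec, ← ih, Nat.sub_sub, Nat.add_comm 1 i]
      ring
  have h2 : ∀ k : Fin (n + 1), XRec p n Ω x k k * algebraMap _ L (OmegaPhi p n Ω k j) =
      (fun k : ℕ => if k < j then XRec p n Ω x k k *
        algebraMap _ L (OmegaRec p Ω k j ^ p ^ (n - 1 - k)) else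
          if k = j then XRec p n Ω x k k else 0) k := by
    intro k
    simp only [OmegaPhi, Fin.lt_def, Fin.ext_iff]
    rcases lt_trichotomy (k : ℕ) j with h | h | h
    · rw [if_neg (by omega), if_neg (by omega), if_pos h]
    · rw [if_neg (by omega), if_pos (by omega), if_neg (by omega), if_pos h, map_one, mul_one]
    · rw [if_pos h, if_neg (by omega), if_neg (by omega), map_zero, mul_zero]
  rw [sum_congr rfl fun k _ => h2 k, Fin.sum_univ_eq_sum_range (fun k : ℕ => if k < j then
    XRec p n Ω x k k * algebraMap _ L (OmegaRec p Ω k j ^ p ^ (n - 1 - k)) else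
      if k = j then XRec p n Ω x k k else 0), ← h1 j]
  have hj : (j : ℕ) + 1 ≤ n + 1 := j.2
  rw [← sum_range_add_sum_Ico _ hj, sum_range_succ, sum_eq_zero (s := Ico _ _), add_zero, add_comm]
  · congr 1
    · rw [if_neg (lt_irrefl _), if_pos rfl]
    · exact sum_congr rfl fun k hk => if_pos (mem_range.1 hk)
  · intro k hk
    have := (mem_Ico.1 hk).1
    rw [if_neg (by omega), if_neg (by omega)]

/-- `[Δ] [Ω^φ] = 1`: apply `σ_i - 1` to `[x_j] = [X_j] [Ω^φ]`. -/
theorem matrix_eq (hσ : ∀ i ≤ n, ∀ j ≤ n, σ i (x j) - x j = if i = j then 1 else 0) :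
    IsUnit (OmegaPhi p n Ω).det ∧ ∀ i j : Fin (n + 1),
      σ i (XRec p n Ω x j j) - XRec p n Ω x j j =
        algebraMap (LaurentSeries F) L ((OmegaPhi p n Ω)⁻¹ i j) := by
  have hle : ∀ i : Fin (n + 1), (i : ℕ) ≤ n := fun i => Nat.lt_succ_iff.1 i.2
  choose Δ hΔ using fun i j : Fin (n + 1) =>
    entriesInBase (p := p) (Ω := Ω) hσ i (hle i) j (hle j)
  have hmul : Matrix.of Δ * OmegaPhi p n Ω = 1 := by
    ext1 i j
    apply (algebraMap (LaurentSeries F) L).injective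
    rw [Matrix.mul_apply, map_sum]
    simp only [map_mul, Matrix.of_apply, hΔ, sub_mul]
    rw [sum_sub_distrib, sum_XRec_mul_OmegaPhi]
    have h1 : ∑ k : Fin (n + 1), σ i (XRec p n Ω x k k) *
        algebraMap _ L (OmegaPhi p n Ω k j) = σ i (x j) := by
      conv_rhs => rw [← sum_XRec_mul_OmegaPhi (p := p) (Ω := Ω) (x := x) j, map_sum]
      simp only [map_mul, AlgEquiv.commutes]
    rw [h1, hσ i (hle i) j (hle j), Matrix.one_apply]
    simp only [Fin.ext_iff]
    split_ifs <;> simp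
  refine ⟨Matrix.isUnit_det_of_left_inverse hmul, fun i j => ?_⟩
  rw [Matrix.inv_eq_left_inv hmul, Matrix.of_apply, hΔ]

lemma isChoice (hL : IsNearOneDim p n b β Ω ε x) [Algebra (ZMod p) L]
    (hσ : ∀ i ≤ n, ∀ j ≤ n, σ i (x j) - x j = if i = j then 1 else 0) :
    IsChoice p n σ (bLow p n b Ω) (fun j => XRec p n Ω x j j) where
  organized := hL.isOrganized hσ
  hasBreak i hi := hL.hasBreak_dual hσ hi
  valuation i hi := by
    rw [hL.fixedBy_succ_eq hσ hi]
    exact (hL.vE_Kfield hi).2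
  artinSchreier i hi := by
    rw [hL.fixedBy_eq hσ (by omega)]
    exact hL.wp_X_mem le_rfl hL.equation hi fun l hl =>
      IntermediateField.subset_adjoin _ _ ⟨l, hl, rfl⟩
  apply_self i hi := by
    have h1 : x i - XRec p n Ω x i i ∈ fixedBy n σ i := by
      rw [hL.fixedBy_eq hσ (by omega)]
      exact sub_XRec_mem i i le_rfl fun l hl =>
        IntermediateField.subset_adjoin _ _ ⟨l, hl, rfl⟩
    have h2 := (IntermediateField.mem_fixedField_iff _ _).1 h1 (σ i)
      (Subgroup.subset_closure ⟨i, ⟨le_rfl, hi⟩, rfl⟩)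
    rw [map_sub, dual_self hσ hi] at h2
    linear_combination -h2

end Dual

lemma isFullyRamifiedAbelian (hL : IsNearOneDim p n b β Ω ε x) [Algebra (ZMod p) L] :
    IsFullyRamifiedAbelian F L (p ^ (n + 1)) where
  isGalois := hL.isGalois.2
  comm := hL.gal_mul_comm
  degree := hL.coord_bijective.1
  ramified := by
    refine ⟨hL.vE_top.1, ?_⟩
    rw [hL.coord_bijective.1]
    exact hL.vE_top.2.2.1

end IsNearOneDim

end

end NearOneDim

end

theorem proposition4p5 {p n : ℕ} [Fact p.Prime]
    {F : Type*} [Field F] [Algebra (ZMod p) F]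
    {L : Type*} [Field L] [Algebra (LaurentSeries F) L]
    {b : ℕ} {β : LaurentSeries F} {Ω ε : ℕ → LaurentSeries F} {x : ℕ → L}
    (hL : NearOneDim.IsNearOneDim p n b β Ω ε x) :
    -- `L / K` is fully ramified, elementary abelian, of degree `p ^ (n + 1)`
    NearOneDim.IsFullyRamifiedAbelian F L (p ^ (n + 1)) ∧
    (∀ τ : L ≃ₐ[LaurentSeries F] L, τ ^ p = 1) ∧
    -- the normalized valuations of `L` and of the fields `K_j` exist and are unique
    (∃! w, NearOneDim.IsNormalizedExtension F L w) ∧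
    (∀ j ≤ n, ∃! w, NearOneDim.IsNormalizedExtension F (NearOneDim.Kfield F x j) w) ∧
    -- the `b_(j)`, in increasing order, are the lower ramification breaks of `L / K`
    (∀ i j, i ≤ j → j ≤ n → NearOneDim.bLow p n b Ω i ≤ NearOneDim.bLow p n b Ω j) ∧
    NearOneDim.lowerBreaks F L = NearOneDim.bLow p n b Ω '' Set.Iic n ∧
    -- `v_j (X_j^{(j)}) = -b_(j)`
    (∀ j ≤ n, ∃ h : NearOneDim.XRec p n Ω x j j ∈ NearOneDim.Kfield F x j,
      NearOneDim.vE F (NearOneDim.Kfield F x j) ⟨NearOneDim.XRec p n Ω x j j, h⟩ =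
        ((-(NearOneDim.bLow p n b Ω j) : ℤ) : WithTop ℤ)) ∧
    IsUnit (NearOneDim.OmegaPhi p n Ω).det ∧
    -- the generators `σ_i` of the Galois group that are dual to the `x_j`
    (∃ σ : ℕ → (L ≃ₐ[LaurentSeries F] L),
      (∀ i ≤ n, ∀ j ≤ n, σ i (x j) - x j = if i = j then 1 else 0) ∧
      (∀ j ≤ n, NearOneDim.fixedBy n σ (j + 1) = NearOneDim.Kfield F x j) ∧
      -- the `σ_i` and the `X_j = X_j^{(j)}` are a legitimate choice, with break numbers `b_(j)`
      NearOneDim.IsChoice p n σ (NearOneDim.bLow p n b Ω)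
        (fun j => NearOneDim.XRec p n Ω x j j) ∧
      -- `[Δ] = [(σ_i - 1) X_j] = [Ω^φ]⁻¹`, a matrix over `K`
      (∀ i j : Fin (n + 1),
        σ i (NearOneDim.XRec p n Ω x j j) - NearOneDim.XRec p n Ω x j j =
          algebraMap (LaurentSeries F) L ((NearOneDim.OmegaPhi p n Ω)⁻¹ i j)) ∧
      NearOneDim.EntriesInBase n σ (fun j => NearOneDim.XRec p n Ω x j j)) ∧
    NearOneDim.SatisfiesAssumption1 p n F L := by
  have := NearOneDim.charP_of_algebra p F L
  let _ : Algebra (ZMod p) L := ZMod.algebra L p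
  obtain ⟨σ, hσ⟩ := hL.exists_dual
  have hent := NearOneDim.IsNearOneDim.entriesInBase (p := p) (Ω := Ω) hσ
  have hmat := NearOneDim.IsNearOneDim.matrix_eq (p := p) (Ω := Ω) hσ
  exact ⟨hL.isFullyRamifiedAbelian, hL.gal_pow_eq_one, ⟨_, hL.vE_top.1, hL.vE_top.2.1⟩,
    fun j hj => (hL.vE_Kfield hj).1, fun i j => hL.bLow_mono, hL.lowerBreaks_eq,
    fun j hj => (hL.vE_Kfield hj).2, hmat.1,
    ⟨σ, hσ, fun j hj => hL.fixedBy_succ_eq hσ hj, hL.isChoice hσ, hmat.2, hent⟩,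
    hL.isFullyRamifiedAbelian, σ, _, _, hL.isChoice hσ, hent⟩
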